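/- Graphs are finite and loopless; multiple edges are allowed. A graph is $m$-tree-connected if it has $m$ pairwise edge-disjoint spanning trees (the null graph, with no vertices, is not $m$-tree-connected). The $m$-tree-connected components of a graph $H$ are its maximal induced $m$-tree-connected subgraphs; their vertex sets partition $V(H)$. Put $$\Omega(H)=|P|-\tfrac12\,e_H(P),$$ where $P$ is the partition of $V(H)$ into the vertex sets of the $2$-tree-connected components of $H$, and $e_H(P)$ is the number of edges of $H$ whose ends lie in different parts of $P$ (so $\Omega=0$ for the null graph). For $S\subseteq V(G)$, let $G\setminus S$ be the graph obtained from $G$ by removing the vertices of $S$, and let $e_G(S)$ be the number of edges of $G$ with both ends in $S$. Theorem. Let $G$ be a $2$-tree-connected graph, let $\lambda\in[0,1/2]$ be a real number, and let $f$ be a positive integer-valued function on $V(G)$. Suppose that for every $S\subseteq V(G)$, $$\Omega(G\setminus S)<\sum_{v\in S}\Big(f(v)+2\lambda-\frac32\Big)+\frac52-\lambda\,\big(e_G(S)+2\big).$$ Then $G$ has a spanning closed trail (a closed walk that uses no edge more than once and meets every vertex) that meets each vertex $v$ at most $f(v)$ times, where the coinciding first and last vertex of the trail is counted once for the closing, and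 the trivial closed trail on a single vertex meets that vertex once. -/

import Mathlib

namespace Graph

/-- A walk from `x` to `y` in a multigraph: an alternating sequence of vertices and edges. -/
inductive Walk {α β : Type*} (G : Graph α β) : α → α → Type _
  | nil (x : α) (hx : x ∈ G.vertexSet) : Walk G x x
  | cons {y z : α} (x : α) (e : β) (h : G.IsLink e x y) (p : Walk G y z) : Walk G x z

namespace Walk

/-- The edges traversed by a walk, in order. -/
def edges {α β : Type*} {G : Graph α β} {x y : α} : G.Walk x y → List β
  | nil _ _ => []
  | cons _ e _ p => e :: p.edges

/-- The sequence of vertices of a walk, with both its first and its last vertex. -/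
def support {α β : Type*} {G : Graph α β} {x y : α} : G.Walk x y → List α
  | nil x _ => [x]
  | cons x _ _ p => x :: p.support

/-- The sequence of vertices of a closed walk read cyclically: the common first and last vertex is
listed once only for the closing of the walk. The trivial walk consists of its single vertex. -/
def cyclicSupport {α β : Type*} {G : Graph α β} {x y : α} : G.Walk x y → List α
  | nil x _ => [x]
  | cons _ _ _ p => p.support

/-- A trail is a walk that uses no edge more than once. -/
def IsTrail {α β : Type*} {G : Graph α β} {x y : α} (p : G.Walk x y) : Prop :=
  p.edges.Nodup

/-- A cycle is a closed trail with at least one edge that repeats no vertex. -/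
def IsCycle {α β : Type*} {G : Graph α β} {x : α} (p : G.Walk x x) : Prop :=
  p.edges ≠ [] ∧ p.IsTrail ∧ p.cyclicSupport.Nodup

open Classical in
/-- The number of times that a closed walk meets the vertex `v`. -/
noncomputable def visits {α β : Type*} {G : Graph α β} {x : α} (p : G.Walk x x) (v : α) : ℕ :=
  p.cyclicSupport.count v

end Walk

/-- A spanning closed trail that meets each vertex `v` at most `f v` times. -/
def HasSpanningClosedTrail {α β : Type*} (G : Graph α β) (f : α → ℕ) : Prop :=
  ∃ (x : α) (p : G.Walk x x), p.IsTrail ∧ ∀ v ∈ G.vertexSet, 1 ≤ p.visits v ∧ p.visits v ≤ f v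

/-- A connected graph; the null graph is not connected. -/
def IsConnected {α β : Type*} (G : Graph α β) : Prop :=
  G.vertexSet.Nonempty ∧ ∀ x ∈ G.vertexSet, ∀ y ∈ G.vertexSet, Nonempty (G.Walk x y)

/-- A tree: a connected graph without cycles. -/
def IsTree {α β : Type*} (G : Graph α β) : Prop :=
  G.IsConnected ∧ ∀ (x : α) (p : G.Walk x x), ¬ p.IsCycle

/-- A graph is `m`-tree-connected if it has `m` pairwise edge-disjoint spanning trees. -/
def IsTreeConnected {α β : Type*} (m : ℕ) (G : Graph α β) : Prop :=
  ∃ T : Fin m → Graph α β, (∀ i, (T i).IsSpanningSubgraph G ∧ (T i).IsTree) ∧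
    ∀ i j, i ≠ j → Disjoint (T i).edgeSet (T j).edgeSet

/-- The partition of the vertex set into the vertex sets of the `m`-tree-connected components,
which are the maximal induced `m`-tree-connected subgraphs. -/
def treeComponents {α β : Type*} (m : ℕ) (G : Graph α β) : Set (Set α) :=
  {C | Maximal (fun X : Set α => X ⊆ G.vertexSet ∧ IsTreeConnected m (G.induce X)) C}

/-- The number of edges whose ends lie in different parts of `P`. -/
noncomputable def crossEdges {α β : Type*} (G : Graph α β) (P : Set (Set α)) : ℕ :=
  {e : β | ∃ x y : α, G.IsLink e x y ∧ ∃ A ∈ P, ∃ B ∈ P, A ≠ B ∧ x ∈ A ∧ y ∈ B}.ncard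

/-- The number of edges with both ends in `S`. -/
noncomputable def insideEdges {α β : Type*} (G : Graph α β) (S : Set α) : ℕ :=
  {e : β | ∃ x ∈ S, ∃ y ∈ S, G.IsLink e x y}.ncard

/-- The tree-connectivity measure `Ω_m(G) = |P| - e_G(P) / m`, where `P` is the partition of the
vertex set into the `m`-tree-connected components. -/
noncomputable def treeOmega {α β : Type*} (m : ℕ) (G : Graph α β) : ℝ :=
  ((treeComponents m G).ncard : ℝ) - (1 / (m : ℝ)) * (G.crossEdges (treeComponents m G) : ℝ)

end Graph

/-! Say that an edge set is sparse if every nonempty vertex set `X` spans at most 2(|X| - 1) of its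
edges, and that `X` is tight if equality holds. By Nash-Williams (`Sparse.exists_forests`) a sparse
edge set splits into two forests, so a sparse set `B` for which the whole vertex set is tight (a
base) is a union of two edge-disjoint spanning trees.

It is enough to find a base with degree at most 2f(v)+1 at every `v`. Between the first tree and the
whole base there is a subgraph with all degrees even (`exists_even_between`). It is connected, so a
longest trail in it is closed and spanning. Each visit to `v` consumes two edges of the base, so
there are at most f(v) visits.

Suppose that no such base exists, and take one of least total excess over the bounds. An exchange
argument (`exists_exchange`, `exists_tight_of_notMem_rigid`) yields a set `S` on which all degrees
are at least 2f+1, one of them larger, and such that every edge of `G` avoiding `S` is in `B` or is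
spanned by a tight set avoiding `S`. Hence the edges of `B` avoiding `S` determine the
2-tree-connected components of `G \ S`, and 2Ω(G \ S) equals 2|V \ S| minus the number of these
edges (`two_mul_treeOmega`). That number is |B| + e_B(S) minus the degree sum over `S`, which gives
Ω(G \ S) ≥ Σ(f - 1/2) + 3/2 - e_B(S)/2. As e_B(S) is at most both 2|S| - 2 and e_G(S), weighting
these bounds with 1/2 - λ and λ contradicts the hypothesis. -/

open Finset
set_option linter.unusedSectionVars false

/-! ### Sparse edge sets, tight vertex sets and edge exchange -/

namespace EdgeCount

variable {α β : Type*} [DecidableEq α] [DecidableEq β]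

/-- The edges of `B` with all ends in `X`, where `g` assigns to each edge its set of ends. -/
def inside (g : β → Finset α) (B : Finset β) (X : Finset α) : Finset β :=
  B.filter (fun e => g e ⊆ X)

/-- The number of edges of `B` at `v`. -/
def deg (g : β → Finset α) (B : Finset β) (v : α) : ℕ :=
  #(B.filter (fun e => v ∈ g e))

/-- Every nonempty vertex set `X` spans at most `k (|X| - 1)` edges of `B`. -/
def Sparse (k : ℕ) (g : β → Finset α) (B : Finset β) : Prop :=
  ∀ X : Finset α, X.Nonempty → #(inside g B X) + k ≤ k * #X

/-- The nonempty vertex set `X` spans exactly `k (|X| - 1)` edges of `B`. -/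
def Tight (k : ℕ) (g : β → Finset α) (B : Finset β) (X : Finset α) : Prop :=
  X.Nonempty ∧ #(inside g B X) + k = k * #X

variable {g : β → Finset α} {B B' E : Finset β} {X Y Z V : Finset α} {k : ℕ}

lemma mem_inside {e : β} : e ∈ inside g B X ↔ e ∈ B ∧ g e ⊆ X := by
  simp [inside]

lemma inside_mono (h : B ⊆ B') (hX : X ⊆ Y) : inside g B X ⊆ inside g B' Y := fun e he => by
  rw [mem_inside] at he ⊢
  exact ⟨h he.1, he.2.trans hX⟩

lemma Sparse.mono (hB : Sparse k g B') (h : B ⊆ B') : Sparse k g B := fun X hX =>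
  (Nat.add_le_add_right (card_le_card (inside_mono h subset_rfl)) k).trans (hB X hX)

lemma inside_eq_self (h : ∀ e ∈ B, g e ⊆ X) : inside g B X = B :=
  filter_true_of_mem h

lemma inside_eq_empty (hB : ∀ e ∈ B, #(g e) = 2) (hX : #X ≤ 1) : inside g B X = ∅ := by
  refine filter_false_of_mem fun e he h => ?_
  have := card_le_card h
  have := hB e he
  omega

lemma inside_inter : inside g B X ∩ inside g B Y = inside g B (X ∩ Y) := by
  ext e
  simp only [mem_inter, mem_inside, subset_inter_iff]
  tauto

lemma card_inside_add_card_inside_le :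
    #(inside g B X) + #(inside g B Y) ≤ #(inside g B (X ∪ Y)) + #(inside g B (X ∩ Y)) := by
  rw [← card_union_add_card_inter, inside_inter]
  exact Nat.add_le_add_right (card_le_card (union_subset
    (inside_mono subset_rfl subset_union_left) (inside_mono subset_rfl subset_union_right))) _

/-- The number of spanned edges is supermodular while the bound 2(|X| - 1) is modular on
intersecting pairs, so equality at `X` and `Y` forces equality at both union and intersection. -/
lemma Tight.union_inter (hB : Sparse 2 g B) (hX : Tight 2 g B X) (hY : Tight 2 g B Y)
    (hXY : (X ∩ Y).Nonempty) : Tight 2 g B (X ∪ Y) ∧ Tight 2 g B (X ∩ Y) := by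
  have h1 := card_inside_add_card_inside_le (g := g) (B := B) (X := X) (Y := Y)
  have hu : (X ∪ Y).Nonempty := hX.1.mono subset_union_left
  have h2 := hB _ hXY
  have h3 := hB _ hu
  have h4 := card_union_add_card_inter X Y
  have h5 := hX.2
  have h6 := hY.2
  exact ⟨⟨hu, by omega⟩, ⟨hXY, by omega⟩⟩

lemma tight_singleton (hB : ∀ e ∈ B, #(g e) = 2) (v : α) : Tight k g B {v} := by
  refine ⟨singleton_nonempty v, ?_⟩
  rw [inside_eq_empty hB (by simp)]
  simp

/-- Among the tight sets containing `P`, there is a least one. -/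
lemma exists_least_tight (hB : Sparse 2 g B) {P : Finset α} (hP : P.Nonempty)
    (h : ∃ X, Tight 2 g B X ∧ P ⊆ X) :
    ∃ Q, Tight 2 g B Q ∧ P ⊆ Q ∧ ∀ X, Tight 2 g B X → P ⊆ X → Q ⊆ X := by
  obtain ⟨Q, ⟨hQ, hPQ⟩, hmin⟩ := WellFounded.has_min (measure (Finset.card (α := α))).wf
    {X | Tight 2 g B X ∧ P ⊆ X} h
  refine ⟨Q, hQ, hPQ, fun X hX hPX => ?_⟩
  have hsub := subset_inter hPQ hPX
  have ht := (hQ.union_inter hB hX (hP.mono hsub)).2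
  have := hmin _ ⟨ht, hsub⟩
  have h2 : #(Q ∩ X) = #Q := le_antisymm (card_le_card inter_subset_left) (not_lt.1 this)
  exact inter_eq_left.1 (eq_of_subset_of_card_le inter_subset_left h2.ge)

lemma Sparse.insert_of_not_tight (hB : Sparse k g B) {e : β}
    (h : ∀ X, Tight k g B X → ¬ g e ⊆ X) : Sparse k g (insert e B) := by
  intro X hX
  have h1 := hB X hX
  by_cases heX : g e ⊆ X
  · have h2 : #(inside g B X) + k ≠ k * #X := fun h' => h X ⟨hX, h'⟩ heX
    have h3 : #(inside g (insert e B) X) ≤ #(inside g B X) + 1 := by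
      refine le_trans (card_le_card ?_) (card_insert_le e _)
      intro b hb
      simp only [mem_inside, mem_insert] at hb ⊢
      tauto
    omega
  · have h3 : inside g (insert e B) X = inside g B X := by
      ext b
      simp only [mem_inside, mem_insert]
      refine ⟨?_, by tauto⟩
      rintro ⟨rfl | h1, h2⟩
      · exact absurd h2 heX
      · exact ⟨h1, h2⟩
    rwa [h3]

/-- An edge can be exchanged for any edge spanned by the least tight set containing its ends. -/
lemma Sparse.exchange (hB : Sparse k g B) {e b : β} {Q : Finset α}
    (hQ : ∀ X, Tight k g B X → g e ⊆ X → Q ⊆ X) (hb : b ∈ inside g B Q) :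
    Sparse k g (insert e (B.erase b)) := by
  rw [mem_inside] at hb
  refine (hB.mono (erase_subset b B)).insert_of_not_tight fun X hX heX => ?_
  have h1 := hB X hX.1
  have h2 := hX.2
  have h3 := card_le_card (inside_mono (g := g) (erase_subset b B) (subset_refl X))
  have hX' : Tight k g B X := ⟨hX.1, by omega⟩
  have hbX : b ∈ inside g B X := mem_inside.2 ⟨hb.1, hb.2.trans (hQ X hX' heX)⟩
  have h4 : inside g (B.erase b) X = (inside g B X).erase b := by
    ext c
    simp only [mem_inside, mem_erase]
    tauto
  have := card_pos.2 ⟨b, hbX⟩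
  rw [h4, card_erase_of_mem hbX] at h2
  omega

/-- Otherwise `X` without `z` spans as many edges as `X`, two more than sparsity allows. -/
lemma Tight.exists_mem (hB : Sparse 2 g B) (hX : Tight 2 g B X) (hcard : 2 ≤ #X) {z : α}
    (hz : z ∈ X) : ∃ b ∈ inside g B X, z ∈ g b := by
  by_contra! hcon
  have h1 : inside g B X ⊆ inside g B (X.erase z) := fun b hb => by
    rw [mem_inside] at hb ⊢
    exact ⟨hb.1, subset_erase.2 ⟨hb.2, hcon b (mem_inside.2 hb)⟩⟩
  have h2 := card_erase_of_mem hz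
  have h3 := hB (X.erase z) (card_pos.1 (by omega))
  have h4 := hX.2
  have h5 := card_le_card h1
  omega

lemma card_inside_add (hXZ : X ⊆ Z) : #(inside g B Z)
    = #(inside g B X) + #(B.filter (fun e => g e ⊆ Z ∧ ¬ g e ⊆ X)) := by
  rw [inside, inside, ← card_union_of_disjoint]
  · congr 1
    ext e
    simp only [mem_filter, mem_union]
    have : g e ⊆ X → g e ⊆ Z := fun h => h.trans hXZ
    tauto
  · rw [disjoint_left]
    intro e
    simp only [mem_filter]
    tauto

/-! ### Changing an edge set inside a tight set -/

/-- `B` and `B'` have the same edges outside `X`. -/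
def AgreeOff (g : β → Finset α) (B B' : Finset β) (X : Finset α) : Prop :=
  ∀ e, ¬ g e ⊆ X → (e ∈ B ↔ e ∈ B')

lemma AgreeOff.filter_eq (h : AgreeOff g B B' X) :
    B.filter (fun e => g e ⊆ Z ∧ ¬ g e ⊆ X) = B'.filter (fun e => g e ⊆ Z ∧ ¬ g e ⊆ X) := by
  ext e
  simp only [mem_filter]
  have := h e
  tauto

lemma AgreeOff.card_inside_iff (h : AgreeOff g B B' X) (hXZ : X ⊆ Z) :
    #(inside g B X) = #(inside g B' X) ↔ #(inside g B Z) = #(inside g B' Z) := by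
  rw [card_inside_add (B := B) hXZ, card_inside_add (B := B') hXZ, h.filter_eq]
  omega

lemma AgreeOff.deg_eq (h : AgreeOff g B B' X) {v : α} (hv : v ∉ X) :
    deg g B v = deg g B' v := by
  unfold deg
  congr 1
  ext e
  simp only [mem_filter]
  have := h e
  have : v ∈ g e → ¬ g e ⊆ X := fun h1 h2 => hv (h2 h1)
  tauto

/-- Replacing the edges that a tight set spans by those of another sparse edge set. -/
def replace (g : β → Finset α) (B B' : Finset β) (X : Finset α) : Finset β :=
  B.filter (fun e => ¬ g e ⊆ X) ∪ inside g B' X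

lemma mem_replace {e : β} :
    e ∈ replace g B B' X ↔ (e ∈ B ∧ ¬ g e ⊆ X) ∨ (e ∈ B' ∧ g e ⊆ X) := by
  simp [replace, mem_inside]

lemma inside_replace : inside g (replace g B B' X) X = inside g B' X := by
  ext e
  simp only [mem_inside, mem_replace]
  tauto

lemma agreeOff_replace : AgreeOff g B (replace g B B' X) X := fun e he => by
  rw [mem_replace]
  tauto

/-- Split the edges spanned by `Z` at `X ∩ Z`. Supermodularity and tightness of `X` leave at most
2(|Z| - |X ∩ Z|) of them outside `X`, and sparsity of `B'` bounds those inside. If `X ∩ Z` is empty,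
nothing inside counts and sparsity of `B` suffices. -/
lemma Sparse.replace (hB : Sparse 2 g B) (hB' : Sparse 2 g B') (hX : Tight 2 g B X)
    (h2 : ∀ e ∈ B', #(g e) = 2) : Sparse 2 g (replace g B B' X) := by
  intro Z hZ
  have e1 : #(inside g (EdgeCount.replace g B B' X) Z)
      = #(inside g B' (X ∩ Z)) + #(B.filter (fun e => g e ⊆ Z ∧ ¬ g e ⊆ X ∩ Z)) := by
    rw [inside, inside, ← card_union_of_disjoint]
    · congr 1
      ext e
      simp only [mem_filter, mem_union, mem_replace, subset_inter_iff]
      tauto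
    · rw [disjoint_left]
      intro e
      simp only [mem_filter]
      tauto
  have e2 := card_inside_add (g := g) (B := B) (inter_subset_right : X ∩ Z ⊆ Z)
  have e3 := card_inside_add_card_inside_le (g := g) (B := B) (X := X) (Y := Z)
  have e4 := hB _ (hX.1.mono (subset_union_left : X ⊆ X ∪ Z))
  have e5 := card_union_add_card_inter X Z
  have e6 := hX.2
  have e7 := hB Z hZ
  rcases (X ∩ Z).eq_empty_or_nonempty with h | h
  · have : inside g B' (X ∩ Z) = ∅ := inside_eq_empty h2 (by simp [h])
    rw [this, card_empty] at e1
    omega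
  · have := hB' _ h
    omega

lemma deg_exchange {e b : β} (he : e ∉ B) (hb : b ∈ B) (v : α) :
    deg g (insert e (B.erase b)) v + (if v ∈ g b then 1 else 0)
      = deg g B v + (if v ∈ g e then 1 else 0) := by
  have h1 : deg g (insert e (B.erase b)) v
      = deg g (B.erase b) v + (if v ∈ g e then 1 else 0) := by
    unfold deg
    rw [filter_insert]
    split_ifs with h
    · rw [card_insert_of_notMem]
      simp [he]
    · rfl
  have h2 : deg g (B.erase b) v + (if v ∈ g b then 1 else 0) = deg g B v := by
    unfold deg
    conv_rhs => rw [← insert_erase hb, filter_insert]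
    split_ifs with h
    · rw [card_insert_of_notMem]
      simp
    · rfl
  omega

end EdgeCount

/-! ### Decomposition of a sparse edge set into two forests -/

namespace EdgeCount

variable {α β : Type*} [DecidableEq α] [DecidableEq β]
variable {g : β → Finset α} {B B' E : Finset β} {X Y Z V : Finset α} {k : ℕ}

lemma sum_deg (hB : ∀ e ∈ B, g e ⊆ V ∧ #(g e) = 2) : ∑ v ∈ V, deg g B v = 2 * #B := by
  have h := sum_card_bipartiteAbove_eq_sum_card_bipartiteBelow (s := V) (t := B)
    (fun v e => v ∈ g e)
  have h2 : ∀ e ∈ B, #(bipartiteBelow (fun v e => v ∈ g e) V e) = 2 := fun e he => by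
    rw [bipartiteBelow, filter_mem_eq_inter, inter_eq_right.2 (hB e he).1, (hB e he).2]
  rw [sum_congr rfl h2, sum_const, smul_eq_mul, mul_comm] at h
  exact h

lemma inside_congr {g' : β → Finset α} (h : ∀ e ∈ B, g e = g' e) :
    inside g B X = inside g' B X :=
  filter_congr fun e he => by rw [h e he]

lemma Sparse.congr {g' : β → Finset α} (hB : Sparse k g B) (h : ∀ e ∈ B, g e = g' e) :
    Sparse k g' B := fun X hX => by
  rw [← inside_congr h]
  exact hB X hX

lemma Tight.congr {g' : β → Finset α} (hX : Tight k g B X) (h : ∀ e ∈ B, g e = g' e) :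
    Tight k g' B X := by
  rw [Tight, ← inside_congr h]
  exact hX

lemma sparse_empty : Sparse k g (∅ : Finset β) := fun X hX => by
  have := Nat.mul_le_mul_left k (card_pos.2 hX)
  simpa [inside] using this

/-- Adding a pendant edge at a new vertex keeps a forest a forest. -/
lemma Sparse.insert_pendant {T : Finset β} (hT : Sparse 1 g T) {v : α} (hv : ∀ e ∈ T, v ∉ g e)
    {p : β} (hp : v ∈ g p) (hp2 : #(g p) = 2) : Sparse 1 g (insert p T) := by
  refine hT.insert_of_not_tight fun X hX hpX => ?_
  obtain ⟨hX1, hX2⟩ := hX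
  have h1 : inside g T X = inside g T (X.erase v) := by
    ext e
    simp only [mem_inside, subset_erase]
    have := hv e
    tauto
  have h2 := card_erase_of_mem (hpX hp)
  have h3 := card_le_card hpX
  have h4 := hT (X.erase v) (card_pos.1 (by omega))
  rw [h1] at hX2
  omega

/-- Subdividing the edge `p` of a forest by a new vertex `v`: the edge `p` becomes an edge from `v`
to `u` and the new edge `q` joins `v` to `w`. -/
lemma Sparse.subdivide {T : Finset β} {p q : β} {v u w : α}
    (hT : Sparse 1 (Function.update g p {u, w}) (insert p T)) (hpT : p ∉ T)
    (hv : ∀ e ∈ T, v ∉ g e) (hp : g p = {v, u}) (hq : g q = {v, w}) (hu : u ≠ v) (hw : w ≠ v) :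
    Sparse 1 g (insert p (insert q T)) := by
  have hcongr : ∀ e ∈ T, Function.update g p {u, w} e = g e := fun e he => by
    rw [Function.update_of_ne]
    rintro rfl
    exact hpT he
  have hT0 : Sparse 1 g T := (hT.mono (subset_insert p T)).congr hcongr
  have hqT : Sparse 1 g (insert q T) :=
    hT0.insert_pendant hv (by simp [hq]) (by rw [hq, card_pair hw.symm])
  refine hqT.insert_of_not_tight fun X hX hpX => ?_
  obtain ⟨hX1, hX2⟩ := hX
  have hvX : v ∈ X := hpX (by simp [hp])
  have huX : u ∈ X := hpX (by simp [hp])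
  have huY : u ∈ X.erase v := mem_erase.2 ⟨hu, huX⟩
  have h1 : inside g T X = inside g T (X.erase v) := by
    ext e
    simp only [mem_inside, subset_erase]
    have := hv e
    tauto
  have h2 := card_erase_of_mem hvX
  have h3 := hT (X.erase v) ⟨u, huY⟩
  have h5 := hT0 (X.erase v) ⟨u, huY⟩
  have h6 : 1 < #X := one_lt_card.2 ⟨u, huX, v, hvX, hu⟩
  by_cases hwX : w ∈ X
  · have h4 : inside (Function.update g p {u, w}) (insert p T) (X.erase v)
        = insert p (inside g T (X.erase v)) := by
      rw [inside, filter_insert, if_pos]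
      · congr 1
        exact filter_congr fun e he => by rw [hcongr e he]
      · simp [insert_subset_iff, huX, hu, hwX, hw]
    rw [h4, card_insert_of_notMem (by simp [mem_inside, hpT])] at h3
    have h7 : #(inside g (insert q T) X) ≤ #(inside g T X) + 1 := by
      refine le_trans (card_le_card ?_) (card_insert_le q _)
      intro b hb
      simp only [mem_inside, mem_insert] at hb ⊢
      tauto
    rw [h1] at h7
    omega
  · have h7 : inside g (insert q T) X = inside g T X := by
      rw [inside, filter_insert, if_neg]
      · rfl
      · intro h
        exact hwX (h (by simp [hq]))
    rw [h7, h1] at hX2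
    omega

/-- The reduction at a vertex `v` of degree three, where the edges `p`, `q` at `v` are replaced by
one edge between their other ends. -/
lemma Sparse.exists_forests_of_deg_three {B₀ : Finset β} {p q r : β} {v u w : α}
    (hB : Sparse 2 g B₀) (hv : ∀ e ∈ B₀, v ∉ g e)
    (hp : g p = {v, u}) (hq : g q = {v, w}) (hu : u ≠ v) (hw : w ≠ v)
    (hr : v ∈ g r) (hr2 : #(g r) = 2) (hpq : p ≠ q) (hpr : p ≠ r) (hqr : q ≠ r)
    (hnt : ∀ X, Tight 2 g B₀ X → ¬ ({u, w} : Finset α) ⊆ X)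
    (ih : ∀ g' : β → Finset α, g' p = {u, w} → (∀ e ∈ B₀, g' e = g e) →
      Sparse 2 g' (insert p B₀) → ∃ T₁ T₂, T₁ ∪ T₂ = insert p B₀ ∧ Disjoint T₁ T₂ ∧
        Sparse 1 g' T₁ ∧ Sparse 1 g' T₂) :
    ∃ T₁ T₂, T₁ ∪ T₂ = insert p (insert q (insert r B₀)) ∧ Disjoint T₁ T₂ ∧
        Sparse 1 g T₁ ∧ Sparse 1 g T₂ := by
  have hpB : p ∉ B₀ := fun h => hv p h (by simp [hp])
  have hqB : q ∉ B₀ := fun h => hv q h (by simp [hq])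
  have hrB : r ∉ B₀ := fun h => hv r h hr
  have hcongr : ∀ e ∈ B₀, Function.update g p {u, w} e = g e := fun e he => by
    rw [Function.update_of_ne]
    rintro rfl
    exact hpB he
  have hsp : Sparse 2 (Function.update g p {u, w}) (insert p B₀) := by
    refine (hB.congr fun e he => (hcongr e he).symm).insert_of_not_tight fun X hX hX2 => ?_
    rw [Function.update_self] at hX2
    exact hnt X (hX.congr hcongr) hX2
  -- The forest containing the shortcut edge is subdivided at `v`, which restores `p` and `q`; the
  -- third edge `r` becomes pendant in the other forest.
  have key : ∀ T₁ T₂ : Finset β, T₁ ∪ T₂ = insert p B₀ → Disjoint T₁ T₂ →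
      Sparse 1 (Function.update g p {u, w}) T₁ → Sparse 1 (Function.update g p {u, w}) T₂ →
      p ∈ T₁ → ∃ T₁ T₂, T₁ ∪ T₂ = insert p (insert q (insert r B₀)) ∧ Disjoint T₁ T₂ ∧
        Sparse 1 g T₁ ∧ Sparse 1 g T₂ := by
    intro T₁ T₂ hU hd h1 h2 hpT
    have hmem : ∀ e, e ∈ T₁ ∨ e ∈ T₂ ↔ e = p ∨ e ∈ B₀ := fun e => by
      rw [← mem_union, hU, mem_insert]
    have hdis : ∀ e, e ∈ T₁ → e ∉ T₂ := fun e h h' => disjoint_left.1 hd h h'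
    have hT1 : T₁.erase p ⊆ B₀ := fun e he => by
      rw [mem_erase] at he
      have := hmem e
      tauto
    have hT2 : T₂ ⊆ B₀ := fun e he => by
      have := hmem e
      have : e ≠ p := by
        rintro rfl
        exact hdis e hpT he
      tauto
    refine ⟨insert p (insert q (T₁.erase p)), insert r T₂, ?_, ?_, ?_, ?_⟩
    · ext e
      have := hmem e
      simp only [mem_union, mem_insert, mem_erase]
      tauto
    · rw [disjoint_left]
      intro e he he'
      simp only [mem_insert, mem_erase] at he he'
      rcases he with rfl | rfl | he <;> rcases he' with rfl | he'
      · exact hpr rfl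
      · exact hdis e hpT he'
      · exact hqr rfl
      · exact hqB (hT2 he')
      · exact hrB (hT1 (mem_erase.2 he))
      · exact hdis e he.2 he'
    · refine Sparse.subdivide (v := v) (u := u) (w := w) ?_ (by simp)
        (fun e he => hv e (hT1 he)) hp hq hu hw
      rwa [insert_erase hpT]
    · exact (h2.congr fun e he => hcongr e (hT2 he)).insert_pendant
        (fun e he => hv e (hT2 he)) hr hr2
  obtain ⟨T₁, T₂, hU, hd, h1, h2⟩ := ih _ (Function.update_self ..) hcongr hsp
  have hpU : p ∈ T₁ ∪ T₂ := by simp [hU]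
  rcases mem_union.1 hpU with h | h
  · exact key T₁ T₂ hU hd h1 h2 h
  · exact key T₂ T₁ (by rw [union_comm, hU]) hd.symm h2 h1 h

/-- The Nash-Williams theorem for two forests. -/
theorem Sparse.exists_forests (hE : ∀ e ∈ B, g e ⊆ V ∧ #(g e) = 2) (hB : Sparse 2 g B) :
    ∃ T₁ T₂, T₁ ∪ T₂ = B ∧ Disjoint T₁ T₂ ∧ Sparse 1 g T₁ ∧ Sparse 1 g T₂ := by
  induction hn : #V generalizing V g B with
  | zero =>
    have : B = ∅ := by
      rw [card_eq_zero] at hn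
      subst hn
      refine eq_empty_of_forall_notMem fun e he => ?_
      have := hE e he
      rw [subset_empty] at this
      simp [this.1] at this
    subst this
    exact ⟨∅, ∅, rfl, disjoint_empty_left _, sparse_empty, sparse_empty⟩
  | succ n ih =>
    have hV : V.Nonempty := card_pos.1 (by omega)
    -- The degree sum is at most 4|V| - 4, so the average degree is below four.
    obtain ⟨v, hvV, hv3⟩ : ∃ v ∈ V, deg g B v ≤ 3 := by
      by_contra! hcon
      have h1 := sum_le_sum (f := fun _ => 4) hcon
      rw [sum_deg hE, sum_const, smul_eq_mul] at h1
      have h2 := hB V hV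
      rw [inside_eq_self fun e he => (hE e he).1] at h2
      omega
    have hcard : #(V.erase v) = n := by rw [card_erase_of_mem hvV]; omega
    set B₀ := B.filter (fun e => v ∉ g e) with hB₀
    have hv0 : ∀ e ∈ B₀, v ∉ g e := fun e he => (mem_filter.1 he).2
    have hE0 : ∀ e ∈ B₀, g e ⊆ V.erase v ∧ #(g e) = 2 := fun e he => by
      have h := mem_filter.1 he
      exact ⟨subset_erase.2 ⟨(hE e h.1).1, h.2⟩, (hE e h.1).2⟩
    have hsp0 : Sparse 2 g B₀ := hB.mono (filter_subset _ _)
    have hDB : B.filter (fun e => v ∈ g e) ∪ B₀ = B := filter_union_filter_not_eq _ _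
    have hD : ∀ e ∈ B.filter (fun e => v ∈ g e), v ∈ g e ∧ #(g e) = 2 := fun e he => by
      rw [mem_filter] at he
      exact ⟨he.2, (hE e he.1).2⟩
    have hd3 : #(B.filter (fun e => v ∈ g e)) ≤ 3 := hv3
    generalize B.filter (fun e => v ∈ g e) = D at hDB hD hd3
    have hnot : ∀ e, v ∈ g e → e ∉ B₀ := fun e he h => hv0 e h he
    interval_cases hDc : #D
    · rw [card_eq_zero] at hDc
      subst hDc
      rw [empty_union] at hDB
      rw [← hDB]
      exact ih hE0 hsp0 hcard
    · obtain ⟨a, rfl⟩ := card_eq_one.1 hDc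
      obtain ⟨T₁, T₂, hU, hd, h1, h2⟩ := ih hE0 hsp0 hcard
      have ha := hD a (by simp)
      refine ⟨insert a T₁, T₂, ?_, ?_, ?_, h2⟩
      · rw [← hDB, ← hU, insert_union]
        rfl
      · rw [disjoint_insert_left]
        exact ⟨fun h => hnot a ha.1 (hU ▸ mem_union_right _ h), hd⟩
      · exact h1.insert_pendant (fun e he => hv0 e (hU ▸ mem_union_left _ he)) ha.1 ha.2
    · obtain ⟨a, b, hab, rfl⟩ := card_eq_two.1 hDc
      obtain ⟨T₁, T₂, hU, hd, h1, h2⟩ := ih hE0 hsp0 hcard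
      have ha := hD a (by simp)
      have hb := hD b (by simp)
      refine ⟨insert a T₁, insert b T₂, ?_, ?_, ?_, ?_⟩
      · rw [← hDB, ← hU]
        ext e
        simp only [mem_union, mem_insert, mem_singleton]
        tauto
      · rw [disjoint_insert_left, mem_insert, disjoint_insert_right]
        refine ⟨?_, fun h => hnot b hb.1 (hU ▸ mem_union_left _ h), hd⟩
        rintro (h | h)
        · exact hab h
        · exact hnot a ha.1 (hU ▸ mem_union_right _ h)
      · exact h1.insert_pendant (fun e he => hv0 e (hU ▸ mem_union_left _ he)) ha.1 ha.2
      · exact h2.insert_pendant (fun e he => hv0 e (hU ▸ mem_union_right _ he)) hb.1 hb.2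
    · obtain ⟨a, b, c, hab, hac, hbc, rfl⟩ := card_eq_three.1 hDc
      have hother : ∀ e ∈ ({a, b, c} : Finset β), ∃ u, u ≠ v ∧ u ∈ V ∧ g e = {v, u} := by
        intro e he
        have h := hD e he
        have heB : e ∈ B := hDB ▸ mem_union_left _ he
        have h1 := card_erase_of_mem h.1
        rw [h.2] at h1
        obtain ⟨u, hu⟩ := card_eq_one.1 h1
        have hu' : u ∈ (g e).erase v := by simp [hu]
        rw [mem_erase] at hu'
        exact ⟨u, hu'.1, (hE e heB).1 hu'.2, by rw [← insert_erase h.1, hu]⟩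
      obtain ⟨x, hxv, hxV, hx⟩ := hother a (by simp)
      obtain ⟨y, hyv, hyV, hy⟩ := hother b (by simp)
      obtain ⟨z, hzv, hzV, hz⟩ := hother c (by simp)
      have hsing : ∀ t, Tight 2 g B₀ {t} := tight_singleton fun e he => (hE0 e he).2
      have ih' : ∀ (p : β) (u w : α), u ∈ V → w ∈ V → u ≠ v → w ≠ v →
          (∀ X, Tight 2 g B₀ X → ¬ ({u, w} : Finset α) ⊆ X) →
          ∀ g' : β → Finset α, g' p = {u, w} → (∀ e ∈ B₀, g' e = g e) →
          Sparse 2 g' (insert p B₀) → ∃ T₁ T₂, T₁ ∪ T₂ = insert p B₀ ∧ Disjoint T₁ T₂ ∧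
            Sparse 1 g' T₁ ∧ Sparse 1 g' T₂ := by
        intro p u w huV hwV huv hwv hnt g' hg'p hg' hsp
        refine ih (V := V.erase v) (fun e he => ?_) hsp hcard
        rcases mem_insert.1 he with rfl | he
        · rw [hg'p]
          refine ⟨by simp [insert_subset_iff, huV, hwV, huv, hwv], card_pair ?_⟩
          rintro rfl
          exact hnt {u} (hsing u) (by simp)
        · rw [hg' e he]
          exact hE0 e he
      by_cases hab' : ∀ X, Tight 2 g B₀ X → ¬ ({x, y} : Finset α) ⊆ X
      · obtain ⟨T₁, T₂, h⟩ := hsp0.exists_forests_of_deg_three hv0 hx hy hxv hyv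
          (hD c (by simp)).1 (hD c (by simp)).2 hab hac hbc hab' (ih' a x y hxV hyV hxv hyv hab')
        refine ⟨T₁, T₂, ?_, h.2⟩
        rw [h.1, ← hDB]
        simp [insert_union]
      by_cases hac' : ∀ X, Tight 2 g B₀ X → ¬ ({x, z} : Finset α) ⊆ X
      · obtain ⟨T₁, T₂, h⟩ := hsp0.exists_forests_of_deg_three hv0 hx hz hxv hzv
          (hD b (by simp)).1 (hD b (by simp)).2 hac hab hbc.symm hac'
          (ih' a x z hxV hzV hxv hzv hac')
        refine ⟨T₁, T₂, ?_, h.2⟩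
        rw [h.1, ← hDB]
        ext e
        simp only [mem_union, mem_insert, mem_singleton]
        tauto
      -- Now neither {x, y} nor {x, z} can be joined by a shortcut. The tight sets blocking them
      -- share `x`, so their union is tight and contains all three neighbours; adding `v` with its
      -- three edges exceeds the sparse bound by one.
      push Not at hab' hac'
      obtain ⟨P, hP, hP2⟩ := hab'
      obtain ⟨Q, hQ, hQ2⟩ := hac'
      have hvnot : ∀ X, Tight 2 g B₀ X → x ∈ X → v ∉ X := fun X hX hxX hvX => by
        obtain ⟨e, he, hve⟩ := hX.exists_mem hsp0
          (one_lt_card.2 ⟨x, hxX, v, hvX, hxv⟩) hvX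
        exact hv0 e (mem_inside.1 he).1 hve
      simp only [insert_subset_iff, singleton_subset_iff] at hP2 hQ2
      have hPQ := (hP.union_inter hsp0 hQ ⟨x, mem_inter.2 ⟨hP2.1, hQ2.1⟩⟩).1
      have hvU := hvnot _ hPQ (mem_union_left _ hP2.1)
      have h1 := hB (insert v (P ∪ Q)) (insert_nonempty _ _)
      rw [card_insert_of_notMem hvU] at h1
      have h2 : inside g B (insert v (P ∪ Q)) ⊇ {a, b, c} ∪ inside g B₀ (P ∪ Q) := by
        refine union_subset ?_ (inside_mono (filter_subset _ _) (subset_insert _ _))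
        intro e he
        refine mem_inside.2 ⟨hDB ▸ mem_union_left _ he, ?_⟩
        simp only [mem_insert, mem_singleton] at he
        rcases he with rfl | rfl | rfl
        · simp [hx, insert_subset_iff, hP2]
        · simp [hy, insert_subset_iff, hP2]
        · simp [hz, insert_subset_iff, hQ2]
      have h3 := card_le_card h2
      rw [card_union_of_disjoint, hDc] at h3
      · have := hPQ.2
        omega
      · rw [disjoint_left]
        intro e he he'
        exact hnot e (hD e he).1 (mem_inside.1 he').1

lemma Sparse.union {F₁ F₂ : Finset β}
    (h1 : Sparse 1 g F₁) (h2 : Sparse 1 g F₂) : Sparse 2 g (F₁ ∪ F₂) := fun Y hY => by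
  have := h1 Y hY
  have := h2 Y hY
  have := card_union_le (inside g F₁ Y) (inside g F₂ Y)
  rw [inside, filter_union]
  rw [inside, inside] at *
  omega

lemma Tight.union {F₁ F₂ : Finset β} (hd : Disjoint F₁ F₂)
    (h1 : Tight 1 g F₁ X) (h2 : Tight 1 g F₂ X) : Tight 2 g (F₁ ∪ F₂) X := by
  have := h1.2
  have := h2.2
  refine ⟨h1.1, ?_⟩
  rw [inside, filter_union, card_union_of_disjoint (disjoint_filter_filter hd)]
  rw [inside] at *
  omega

end EdgeCount

/-! ### Bases of least excess and the obstruction set -/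

namespace EdgeCount

variable {α β : Type*} [DecidableEq α] [DecidableEq β]
variable {g : β → Finset α} {B B' E : Finset β} {X Y Z V W : Finset α} {h : α → ℕ}

/-- The degree of `u` can be pushed below `h u` by changing `B` inside a tight set that avoids `W`,
keeping the degrees outside `W` within `h`. -/
def Fixable (g : β → Finset α) (E : Finset β) (V : Finset α) (h : α → ℕ) (B : Finset β)
    (W : Finset α) (u : α) : Prop :=
  ∃ B' ⊆ E, Sparse 2 g B' ∧ Tight 2 g B' V ∧ ∃ X ⊆ V, Tight 2 g B X ∧ u ∈ X ∧ Disjoint X W ∧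
    AgreeOff g B B' X ∧ (∀ v ∈ V, v ∉ W → deg g B' v ≤ h v) ∧ deg g B' u < h u

lemma Fixable.notMem {u : α} (hu : Fixable g E V h B W u) : u ∉ W := by
  obtain ⟨B', -, -, -, X, -, -, huX, hXW, -⟩ := hu
  exact disjoint_left.1 hXW huX

/-- The fixes at `x` and at `y` live in tight sets `X` and `Y` avoiding `W`. These are disjoint, so
both fixes can be made at once, which leaves room for `e` at its two ends. The least tight set then
containing `e` must meet `W`, so `e` can be traded for an edge at some `z` in `W`: the degree of `z`
drops, and no bound outside `W` is broken. The set `M'` confines the change without adding vertices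
of `W` to `M`; the induction over the rigid sequence needs this. -/
lemma Fixable.exists_exchange (hE : ∀ e ∈ E, g e ⊆ V ∧ #(g e) = 2) (hBE : B ⊆ E)
    (hB : Sparse 2 g B) (hBV : Tight 2 g B V) {x y : α} {e : β} (he : e ∈ E) (heB : e ∉ B)
    (hexy : g e = {x, y}) (hx : Fixable g E V h B W x) (hy : Fixable g E V h B W y)
    {M : Finset α} (hMV : M ⊆ V) (hM : Tight 2 g B M) (hxM : x ∈ M) (hyM : y ∈ M)
    (hsep : ∀ X ⊆ V, Tight 2 g B X → x ∈ X → y ∈ X → ¬ Disjoint X W) :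
    ∃ B' ⊆ E, Sparse 2 g B' ∧ Tight 2 g B' V ∧ ∃ M' ⊆ V, Tight 2 g B M' ∧
      (∀ v ∈ M', v ∈ W → v ∈ M) ∧ AgreeOff g B B' M' ∧ (∀ v ∈ V, v ∉ W → deg g B' v ≤ h v) ∧
      (∀ v ∈ W, deg g B' v ≤ deg g B v) ∧ ∃ z ∈ M', z ∈ W ∧ deg g B' z < deg g B z := by
  obtain ⟨Bx, hBxE, hBx, hBxV, X, hXV, hX, hxX, hXW, hXagree, hXdeg, hxdeg⟩ := hx
  obtain ⟨By, hByE, hBy, hByV, Y, hYV, hY, hyY, hYW, hYagree, hYdeg, hydeg⟩ := hy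
  have hXY : Disjoint X Y := by
    by_contra hcon
    rw [disjoint_iff_inter_eq_empty, ← ne_eq, ← nonempty_iff_ne_empty] at hcon
    exact hsep _ (union_subset hXV hYV) (hX.union_inter hB hY hcon).1 (mem_union_left _ hxX)
      (mem_union_right _ hyY) (disjoint_union_left.2 ⟨hXW, hYW⟩)
  have hxy : x ≠ y := by
    rintro rfl
    exact disjoint_left.1 hXY hxX hyY
  have hcardV : #(inside g Bx V) = #(inside g B V) := by
    have := hBV.2
    have := hBxV.2
    omega
  have hcardV' : #(inside g By V) = #(inside g B V) := by
    have := hBV.2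
    have := hByV.2
    omega
  have hcardX : #(inside g B X) = #(inside g Bx X) := (hXagree.card_inside_iff hXV).2 hcardV.symm
  have hcardY : #(inside g B Y) = #(inside g By Y) := (hYagree.card_inside_iff hYV).2 hcardV'.symm
  -- edges inside `Y` are not inside `X`
  have hne : ∀ e ∈ E, g e ⊆ X → ¬ g e ⊆ Y := fun e he h1 h2 => by
    obtain ⟨a, ha⟩ : (g e).Nonempty := card_pos.1 (by rw [(hE e he).2]; omega)
    exact disjoint_left.1 hXY (h1 ha) (h2 ha)
  have hBxY : inside g Bx Y = inside g B Y := by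
    ext e
    simp only [mem_inside]
    refine and_congr_left fun heY => ?_
    by_cases heE : e ∈ E
    · exact (hXagree e fun heX => hne e heE heX heY).symm
    · exact ⟨fun h => absurd (hBxE h) heE, fun h => absurd (hBE h) heE⟩
  have hYBx : Tight 2 g Bx Y := ⟨hY.1, by rw [hBxY]; exact hY.2⟩
  -- `B₁` carries both fixes: it follows `Bx` off `Y` and `By` inside `Y`.
  set B₁ := replace g Bx By Y with hB₁
  have hB₁E : B₁ ⊆ E := fun e he => by
    rcases mem_replace.1 he with h | h
    · exact hBxE h.1
    · exact hByE h.1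
  have hsp1 : Sparse 2 g B₁ := hBx.replace hBy hYBx fun e he => (hE e (hByE he)).2
  have hag1 : AgreeOff g Bx B₁ Y := agreeOff_replace
  have hcard1 : #(inside g Bx Y) = #(inside g B₁ Y) := by
    rw [inside_replace, hBxY, hcardY]
  have hcount : ∀ Z, X ⊆ Z → Y ⊆ Z → #(inside g B Z) = #(inside g B₁ Z) := fun Z hXZ hYZ =>
    ((hXagree.card_inside_iff hXZ).1 hcardX).trans ((hag1.card_inside_iff hYZ).1 hcard1)
  have hXB₁ : Tight 2 g B₁ X := by
    have h1 : inside g B₁ X = inside g Bx X := by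
      ext e
      simp only [mem_inside]
      refine and_congr_left fun heX => ?_
      by_cases heE : e ∈ E
      · exact (hag1 e (hne e heE heX)).symm
      · exact ⟨fun h => absurd (hB₁E h) heE, fun h => absurd (hBxE h) heE⟩
    exact ⟨hX.1, by rw [h1, ← hcardX]; exact hX.2⟩
  have hYB₁ : Tight 2 g B₁ Y := ⟨hY.1, by rw [← hcard1, hBxY]; exact hY.2⟩
  -- enlarge `M` so that it contains `X` and `Y`
  have hMX := (hM.union_inter hB hX ⟨x, mem_inter.2 ⟨hxM, hxX⟩⟩).1
  have hMXY := (hMX.union_inter hB hY ⟨y, mem_inter.2 ⟨mem_union_left _ hyM, hyY⟩⟩).1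
  set M' := M ∪ X ∪ Y with hM'
  have hXM' : X ⊆ M' := subset_union_right.trans subset_union_left
  have hYM' : Y ⊆ M' := subset_union_right
  have hM'V : M' ⊆ V := union_subset (union_subset hMV hXV) hYV
  have hM'B₁ : Tight 2 g B₁ M' := ⟨hMXY.1, by rw [← hcount M' hXM' hYM']; exact hMXY.2⟩
  have hgeM' : g e ⊆ M' := by
    rw [hexy, insert_subset_iff, singleton_subset_iff]
    exact ⟨hXM' hxX, hYM' hyY⟩
  obtain ⟨Q, hQ, heQ, hQmin⟩ := exists_least_tight hsp1 (P := g e)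
    (by rw [hexy]; exact insert_nonempty _ _) ⟨M', hM'B₁, hgeM'⟩
  have hQM' : Q ⊆ M' := hQmin _ hM'B₁ hgeM'
  have hxQ : x ∈ Q := heQ (by simp [hexy])
  have hyQ : y ∈ Q := heQ (by simp [hexy])
  -- If `Q` avoided `W`, then `Q ∪ X ∪ Y` would be tight for `B₁`, hence for `B`, contrary to
  -- `hsep`.
  obtain ⟨z, hzQ, hzW⟩ : ∃ z ∈ Q, z ∈ W := by
    by_contra! hcon
    have h1 := (hQ.union_inter hsp1 hXB₁ ⟨x, mem_inter.2 ⟨hxQ, hxX⟩⟩).1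
    have h2 := (h1.union_inter hsp1 hYB₁ ⟨y, mem_inter.2 ⟨mem_union_left _ hyQ, hyY⟩⟩).1
    refine hsep (Q ∪ X ∪ Y) (union_subset (union_subset (hQM'.trans hM'V) hXV) hYV) ⟨h2.1, ?_⟩
      (mem_union_left _ (mem_union_left _ hxQ)) (mem_union_right _ hyY) ?_
    · rw [hcount _ (subset_union_right.trans subset_union_left) subset_union_right]
      exact h2.2
    · rw [disjoint_union_left, disjoint_union_left]
      exact ⟨⟨disjoint_left.2 hcon, hXW⟩, hYW⟩
  obtain ⟨b, hbQ, hzb⟩ := hQ.exists_mem hsp1 (one_lt_card.2 ⟨x, hxQ, y, hyQ, hxy⟩) hzQ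
  have hb := mem_inside.1 hbQ
  have heX : ¬ g e ⊆ X := fun h' => disjoint_left.1 hXY (h' (by simp [hexy])) hyY
  have heY : ¬ g e ⊆ Y := fun h' => disjoint_left.1 hXY hxX (h' (by simp [hexy]))
  have heB₁ : e ∉ B₁ := fun h' => heB ((hXagree e heX).2 ((hag1 e heY).2 h'))
  have hdeg1X : ∀ v, v ∉ Y → deg g B₁ v = deg g Bx v := fun v hv => (hag1.deg_eq hv).symm
  have hdeg1Y : ∀ v ∈ Y, deg g B₁ v = deg g By v := fun v hv => by
    unfold deg
    congr 1
    ext c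
    simp only [mem_filter]
    refine and_congr_left fun hvc => ?_
    rw [mem_replace]
    by_cases hcY : g c ⊆ Y
    · tauto
    · have hcX : ¬ g c ⊆ X := fun h' => disjoint_left.1 hXY (h' hvc) hv
      have := hXagree c hcX
      have := hYagree c hcY
      tauto
  have hdegW : ∀ v ∈ W, deg g B₁ v = deg g B v := fun v hv => by
    rw [hdeg1X v fun h' => disjoint_left.1 hYW h' hv,
      hXagree.deg_eq fun h' => disjoint_left.1 hXW h' hv]
  have hex := deg_exchange (g := g) heB₁ hb.1
  have hWe : ∀ v ∈ W, v ∉ g e := fun v hv hve => by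
    rw [hexy, mem_insert, mem_singleton] at hve
    rcases hve with rfl | rfl
    · exact disjoint_left.1 hXW hxX hv
    · exact disjoint_left.1 hYW hyY hv
  refine ⟨insert e (B₁.erase b), insert_subset he ((erase_subset _ _).trans hB₁E),
    hsp1.exchange hQmin hbQ, ⟨hBV.1, ?_⟩, M', hM'V, hMXY, ?_, ?_, ?_, ?_, z, hQM' hzQ, hzW, ?_⟩
  · rw [inside_eq_self fun c hc => ?_, card_insert_of_notMem, card_erase_of_mem hb.1]
    · have h1 := hcount V hXV hYV
      rw [inside_eq_self (B := B₁) fun c hc => (hE c (hB₁E hc)).1] at h1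
      have := hBV.2
      have := card_pos.2 ⟨b, hb.1⟩
      omega
    · simp [heB₁]
    · rcases mem_insert.1 hc with rfl | hc
      · exact (hE _ he).1
      · exact (hE _ (hB₁E (mem_of_mem_erase hc))).1
  · intro v hv hvW
    rw [hM', mem_union, mem_union] at hv
    rcases hv with (hv | hv) | hv
    · exact hv
    · exact absurd hvW (disjoint_left.1 hXW hv)
    · exact absurd hvW (disjoint_left.1 hYW hv)
  · intro c hc
    have h1 := hXagree c fun h' => hc (h'.trans hXM')
    have h2 := hag1 c fun h' => hc (h'.trans hYM')
    have h3 : c ≠ e := by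
      rintro rfl
      exact hc hgeM'
    have h4 : c ≠ b := by
      rintro rfl
      exact hc (hb.2.trans hQM')
    simp only [mem_insert, mem_erase]
    tauto
  -- Only `x` and `y` can gain an edge, and the strict inequality in their fixes pays for it.
  · intro v hvV hvW
    have h1 := hex v
    by_cases hvx : v = x
    · subst hvx
      have h2 := hdeg1X v (disjoint_left.1 hXY hxX)
      split_ifs at h1 <;> omega
    by_cases hvy : v = y
    · subst hvy
      have h2 := hdeg1Y v hyY
      split_ifs at h1 <;> omega
    have hve : v ∉ g e := by simp [hexy, hvx, hvy]
    rw [if_neg hve] at h1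
    by_cases hvY : v ∈ Y
    · have h2 := hdeg1Y v hvY
      have h3 := hYdeg v hvV hvW
      omega
    · have h2 := hdeg1X v hvY
      have h3 := hXdeg v hvV hvW
      omega
  · intro v hv
    have h1 := hex v
    rw [if_neg (hWe v hv)] at h1
    have := hdegW v hv
    omega
  · have h1 := hex z
    rw [if_neg (hWe z hzW), if_pos hzb] at h1
    have := hdegW z hzW
    omega

open Classical in
/-- The vertices that are not fixable with respect to `W`. -/
noncomputable def unfixable (g : β → Finset α) (E : Finset β) (V : Finset α) (h : α → ℕ)
    (B : Finset β) (W : Finset α) : Finset α :=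
  V.filter (fun v => ¬ Fixable g E V h B W v)

/-- The increasing sequence of vertex sets that starts with the vertices of too large degree and
collects the vertices that cannot be fixed without changing the previous set. -/
noncomputable def rigid (g : β → Finset α) (E : Finset β) (V : Finset α) (h : α → ℕ)
    (B : Finset β) : ℕ → Finset α
  | 0 => V.filter (fun v => h v < deg g B v)
  | n + 1 => unfixable g E V h B (rigid g E V h B n)

lemma rigid_subset (n : ℕ) : rigid g E V h B n ⊆ V := by
  cases n with
  | zero => exact filter_subset _ _
  | succ n =>
    classical
    intro v hv
    simp only [rigid, unfixable, mem_filter] at hv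
    exact hv.1

lemma mem_rigid_zero {v : α} : v ∈ rigid g E V h B 0 ↔ v ∈ V ∧ h v < deg g B v := by
  simp [rigid]

lemma mem_rigid_succ {n : ℕ} {v : α} : v ∈ rigid g E V h B (n + 1) ↔
    v ∈ V ∧ ¬ Fixable g E V h B (rigid g E V h B n) v := by
  simp [rigid, unfixable]

lemma rigid_subset_succ (n : ℕ) : rigid g E V h B n ⊆ rigid g E V h B (n + 1) := fun v hv => by
  rw [mem_rigid_succ]
  exact ⟨rigid_subset n hv, fun hfix => hfix.notMem hv⟩

lemma rigid_mono : Monotone (rigid g E V h B) := monotone_nat_of_le_succ rigid_subset_succ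

lemma deg_le_of_notMem_rigid {n : ℕ} {v : α} (hvV : v ∈ V) (hv : v ∉ rigid g E V h B n) :
    deg g B v ≤ h v := by
  by_contra! hcon
  exact hv (rigid_mono (Nat.zero_le n) (mem_rigid_zero.2 ⟨hvV, hcon⟩))

lemma le_deg_of_mem_rigid (hE : ∀ e ∈ E, g e ⊆ V ∧ #(g e) = 2) (hBE : B ⊆ E)
    (hB : Sparse 2 g B) (hBV : Tight 2 g B V) {n : ℕ} {v : α}
    (hv : v ∈ rigid g E V h B n) : h v ≤ deg g B v := by
  induction n with
  | zero =>
    rw [mem_rigid_zero] at hv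
    exact hv.2.le
  | succ n ih =>
    by_cases hvn : v ∈ rigid g E V h B n
    · exact ih hvn
    · rw [mem_rigid_succ] at hv
      by_contra! hcon
      -- A vertex with slack outside the previous set is fixed by `B` itself, with a singleton as
      -- the tight set.
      exact hv.2 ⟨B, hBE, hB, hBV, {v}, by simpa using hv.1,
        tight_singleton (fun e he => (hE e (hBE he)).2) v, by simp, by simpa using hvn,
        fun _ _ => Iff.rfl, fun w hwV hw => deg_le_of_notMem_rigid hwV hw, hcon⟩

/-- If every tight set containing both ends meets the rigid set at level `n`, `exists_exchange`
applies. At level zero the exchange lowers the total excess, against minimality. At a later level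
the tight set from the previous level serves as `M`, and the exchange fixes a vertex of the current
rigid set with respect to the previous one, against its being unfixable. -/
lemma exists_tight_of_notMem_rigid (hE : ∀ e ∈ E, g e ⊆ V ∧ #(g e) = 2) (hBE : B ⊆ E)
    (hB : Sparse 2 g B) (hBV : Tight 2 g B V)
    (hmin : ∀ B' ⊆ E, Sparse 2 g B' → Tight 2 g B' V →
      ∑ v ∈ V, (deg g B v - h v) ≤ ∑ v ∈ V, (deg g B' v - h v))
    {x y : α} {e : β} (he : e ∈ E) (heB : e ∉ B) (hexy : g e = {x, y}) {n : ℕ}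
    (hx : x ∉ rigid g E V h B (n + 1)) (hy : y ∉ rigid g E V h B (n + 1)) :
    ∃ X ⊆ V, Tight 2 g B X ∧ x ∈ X ∧ y ∈ X ∧ Disjoint X (rigid g E V h B n) := by
  have hxV : x ∈ V := (hE e he).1 (by simp [hexy])
  have hyV : y ∈ V := (hE e he).1 (by simp [hexy])
  have hfix : ∀ (n : ℕ) (u : α), u ∈ V → u ∉ rigid g E V h B (n + 1) →
      Fixable g E V h B (rigid g E V h B n) u := fun n u huV hu => by
    simp only [mem_rigid_succ, not_and, not_not] at hu
    exact hu huV
  induction n with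
  | zero =>
    by_contra! hcon
    obtain ⟨B', hB'E, hB', hB'V, M', hM'V, -, -, -, hle, hleW, z, hzM, hzW, hz⟩ :=
      (hfix 0 x hxV hx).exists_exchange hE hBE hB hBV he heB hexy (hfix 0 y hyV hy)
      subset_rfl hBV hxV hyV hcon
    refine (hmin B' hB'E hB' hB'V).not_gt (sum_lt_sum (fun v hv => ?_) ⟨z, hM'V hzM, ?_⟩)
    · by_cases hvW : v ∈ rigid g E V h B 0
      · exact Nat.sub_le_sub_right (hleW v hvW) _
      · have := hle v hv hvW
        omega
    · rw [mem_rigid_zero] at hzW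
      omega
  | succ n ih =>
    by_contra! hcon
    obtain ⟨M, hMV, hM, hxM, hyM, hMW⟩ := ih (fun h' => hx (rigid_subset_succ _ h'))
      (fun h' => hy (rigid_subset_succ _ h'))
    obtain ⟨B', hB'E, hB', hB'V, M', hM'V, hM', hM'W, hag, hle, hleW, z, hzM, hzW, hz⟩ :=
      (hfix _ x hxV hx).exists_exchange hE hBE hB hBV he heB hexy (hfix _ y hyV hy)
      hMV hM hxM hyM hcon
    have hzn : z ∉ rigid g E V h B n := disjoint_left.1 hMW (hM'W z hzM hzW)
    have hzW' := hzW
    rw [mem_rigid_succ] at hzW'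
    refine hzW'.2 ⟨B', hB'E, hB', hB'V, M', hM'V, hM', hzM, ?_, hag, ?_, ?_⟩
    · rw [disjoint_left]
      intro v hv hvn
      exact disjoint_left.1 hMW (hM'W v hv (rigid_subset_succ _ hvn)) hvn
    · intro v hvV hvn
      by_cases hvW : v ∈ rigid g E V h B (n + 1)
      · exact (hleW v hvW).trans (deg_le_of_notMem_rigid hvV hvn)
      · exact hle v hvV hvW
    · exact hz.trans_le (deg_le_of_notMem_rigid hzW'.1 hzn)

/-- If no base respects the degree bounds `h`, then there is a base together with a vertex set of
large total degree whose removal leaves a base of the remaining graph. -/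
theorem exists_bounded_or_obstruction (hE : ∀ e ∈ E, g e ⊆ V ∧ #(g e) = 2)
    (hex : ∃ B ⊆ E, Sparse 2 g B ∧ Tight 2 g B V) (h : α → ℕ) :
    (∃ B ⊆ E, Sparse 2 g B ∧ Tight 2 g B V ∧ ∀ v ∈ V, deg g B v ≤ h v) ∨
    ∃ B ⊆ E, Sparse 2 g B ∧ Tight 2 g B V ∧ ∃ S ⊆ V, (∀ v ∈ S, h v ≤ deg g B v) ∧
      (∃ v ∈ S, h v < deg g B v) ∧ ∀ e ∈ E, Disjoint (g e) S → e ∈ B ∨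
        ∃ X ⊆ V, Tight 2 g B X ∧ g e ⊆ X ∧ Disjoint X S := by
  obtain ⟨B, ⟨hBE, hB, hBV⟩, hmin⟩ := WellFounded.has_min
    (measure fun B : Finset β => ∑ v ∈ V, (deg g B v - h v)).wf
    {B | B ⊆ E ∧ Sparse 2 g B ∧ Tight 2 g B V} hex
  by_cases hgood : ∀ v ∈ V, deg g B v ≤ h v
  · exact Or.inl ⟨B, hBE, hB, hBV, hgood⟩
  push Not at hgood
  refine Or.inr ⟨B, hBE, hB, hBV, ?_⟩
  -- The rigid sets increase inside the finite set `V`. At a level where they stabilise, an edge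
  -- avoiding the set also avoids its successor, as the previous lemma requires.
  obtain ⟨n, hn⟩ : ∃ n, rigid g E V h B (n + 1) = rigid g E V h B n := by
    by_contra! hcon
    have hgrow : ∀ n, n ≤ #(rigid g E V h B n) := fun n => by
      induction n with
      | zero => exact Nat.zero_le _
      | succ n ih =>
        have := card_lt_card ((rigid_subset_succ (g := g) (E := E) (V := V) (h := h) (B := B)
          n).ssubset_of_ne (hcon n).symm)
        omega
    have h1 := hgrow (#V + 1)
    have h2 := card_le_card (rigid_subset (g := g) (E := E) (V := V) (h := h) (B := B) (#V + 1))
    omega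
  refine ⟨rigid g E V h B n, rigid_subset n,
    fun v hv => le_deg_of_mem_rigid hE hBE hB hBV hv, ?_, ?_⟩
  · obtain ⟨v, hvV, hv⟩ := hgood
    exact ⟨v, rigid_mono (Nat.zero_le n) (mem_rigid_zero.2 ⟨hvV, hv⟩), hv⟩
  · intro e he hdis
    by_cases heB : e ∈ B
    · exact Or.inl heB
    right
    obtain ⟨x, y, -, hexy⟩ := card_eq_two.1 (hE e he).2
    rw [hexy, disjoint_insert_left, disjoint_singleton_left, ← hn] at hdis
    obtain ⟨X, hXV, hX, hxX, hyX, hXW⟩ := exists_tight_of_notMem_rigid hE hBE hB hBV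
      (fun B' h1 h2 h3 => not_lt.1 (hmin B' ⟨h1, h2, h3⟩)) he heB hexy hdis.1 hdis.2
    exact ⟨X, hXV, hX, by simp [hexy, insert_subset_iff, hxX, hyX], hXW⟩

end EdgeCount

/-! ### Walks, and trees as sparse edge sets for which the vertex set is tight -/

namespace Graph

open EdgeCount

variable {α β : Type*} {G T : Graph α β} {x y z : α}

namespace Walk

lemma length_support (p : G.Walk x y) : p.support.length = p.edges.length + 1 := by
  induction p with
  | nil => rfl
  | cons x e h p ih => simp [support, edges, ih]

lemma start_mem_support (p : G.Walk x y) : x ∈ p.support := by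
  cases p <;> simp [support]

lemma end_mem_support (p : G.Walk x y) : y ∈ p.support := by
  induction p with
  | nil => simp [support]
  | cons x e h p ih => simp [support, ih]

lemma mem_vertexSet_of_mem_support (p : G.Walk x y) : ∀ v ∈ p.support, v ∈ G.vertexSet := by
  induction p with
  | nil x hx =>
    intro v hv
    simp only [support, List.mem_singleton] at hv
    exact hv ▸ hx
  | cons x e h p ih =>
    intro v hv
    rcases List.mem_cons.1 hv with rfl | hv
    · exact h.left_mem
    · exact ih v hv

lemma mem_edgeSet_of_mem_edges (p : G.Walk x y) : ∀ e ∈ p.edges, e ∈ G.edgeSet := by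
  induction p with
  | nil => simp [edges]
  | cons x e h p ih =>
    intro e' he'
    rcases List.mem_cons.1 he' with rfl | he'
    · exact h.edge_mem
    · exact ih e' he'

lemma mem_support_of_inc (p : G.Walk x y) : ∀ e ∈ p.edges, ∀ v, G.Inc e v → v ∈ p.support := by
  induction p with
  | nil => simp [edges]
  | cons x e h p ih =>
    intro e' he' v hv
    rcases List.mem_cons.1 he' with rfl | he'
    · rcases hv.eq_or_eq_of_isLink h with rfl | rfl
      · simp [support]
      · simp [support, p.start_mem_support]
    · exact List.mem_cons_of_mem _ (ih e' he' v hv)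

lemma exists_suffix (p : G.Walk x y) (hz : z ∈ p.support) :
    ∃ q : G.Walk z y, q.support <:+ p.support ∧ q.edges <:+ p.edges := by
  induction p with
  | nil x hx =>
    simp only [support, List.mem_singleton] at hz
    subst hz
    exact ⟨nil z hx, List.suffix_rfl, List.suffix_rfl⟩
  | cons x e h p ih =>
    rcases List.mem_cons.1 hz with rfl | hz
    · exact ⟨cons z e h p, List.suffix_rfl, List.suffix_rfl⟩
    · obtain ⟨q, h1, h2⟩ := ih hz
      exact ⟨q, h1.trans (List.suffix_cons _ _), h2.trans (List.suffix_cons _ _)⟩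

lemma exists_path (p : G.Walk x y) :
    ∃ q : G.Walk x y, q.support.Nodup ∧ q.edges ⊆ p.edges := by
  induction p with
  | nil x hx => exact ⟨nil x hx, by simp [support], List.Subset.refl _⟩
  | cons x e h p ih =>
    obtain ⟨q, h1, h2⟩ := ih
    by_cases hx : x ∈ q.support
    · obtain ⟨r, h3, h4⟩ := q.exists_suffix hx
      exact ⟨r, h1.sublist h3.sublist, fun a ha => List.mem_cons_of_mem _ (h2 (h4.subset ha))⟩
    · exact ⟨cons x e h q, List.nodup_cons.2 ⟨hx, h1⟩, List.cons_subset_cons _ h2⟩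

lemma isTrail_of_nodup_support (p : G.Walk x y) (hp : p.support.Nodup) : p.IsTrail := by
  induction p with
  | nil => simp [IsTrail, edges]
  | cons x e h p ih =>
    obtain ⟨h1, h2⟩ := List.nodup_cons.1 hp
    exact List.nodup_cons.2 ⟨fun he => h1 (p.mem_support_of_inc e he x h.inc_left), ih h2⟩

end Walk

variable [DecidableEq α] {g : β → Finset α} {X V : Finset α}

/-- The map `g` gives the set of ends of each edge of `G`. -/
def IsEnds (G : Graph α β) (g : β → Finset α) : Prop :=
  ∀ e x y, G.IsLink e x y → g e = {x, y}

lemma exists_isEnds (G : Graph α β) : ∃ g, G.IsEnds g := by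
  classical
  refine ⟨fun e => if h : ∃ p : α × α, G.IsLink e p.1 p.2 then {h.choose.1, h.choose.2} else ∅,
    fun e x y h => ?_⟩
  have hex : ∃ p : α × α, G.IsLink e p.1 p.2 := ⟨(x, y), h⟩
  simp only [dif_pos hex]
  rcases h.eq_and_eq_or_eq_and_eq hex.choose_spec with ⟨h1, h2⟩ | ⟨h1, h2⟩
  · rw [← h1, ← h2]
  · rw [← h1, ← h2, pair_comm]

lemma IsEnds.mono (hg : G.IsEnds g) (h : T ≤ G) : T.IsEnds g :=
  fun e x y he => hg e x y (he.mono h)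

lemma IsEnds.mem_iff_inc (hg : G.IsEnds g) {e : β} (he : e ∈ G.edgeSet) {v : α} :
    v ∈ g e ↔ G.Inc e v := by
  obtain ⟨x, y, h⟩ := exists_isLink_of_mem_edgeSet he
  rw [hg e x y h, mem_insert, mem_singleton]
  refine ⟨?_, fun hv => hv.eq_or_eq_of_isLink h⟩
  rintro (rfl | rfl)
  · exact h.inc_left
  · exact h.inc_right

lemma IsEnds.coe_subset_vertexSet (hg : G.IsEnds g) {e : β} (he : e ∈ G.edgeSet) :
    (g e : Set α) ⊆ G.vertexSet := fun _ hv =>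
  ((hg.mem_iff_inc he).1 hv).vertex_mem

lemma IsEnds.card_eq (hg : G.IsEnds g) [G.Loopless] {e : β} (he : e ∈ G.edgeSet) :
    #(g e) = 2 := by
  obtain ⟨x, y, h⟩ := exists_isLink_of_mem_edgeSet he
  rw [hg e x y h, card_pair h.ne]

variable [DecidableEq β] {F : Finset β}

/-- If no edge leaves the set of vertices with property `R`, then the edges split. -/
lemma card_le_card_inside_add {R : α → Prop} [DecidablePred R] (hF : ∀ e ∈ F, g e ⊆ X)
    (hR : ∀ e ∈ F, (∀ v ∈ g e, R v) ∨ ∀ v ∈ g e, ¬ R v) :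
    #F ≤ #(inside g F (X.filter R)) + #(inside g F (X.filter fun v => ¬ R v)) := by
  refine le_trans (card_le_card fun e he => ?_) (card_union_le _ _)
  rw [mem_union, mem_inside, mem_inside]
  rcases hR e he with h | h
  · exact Or.inl ⟨he, fun v hv => mem_filter.2 ⟨hF e he hv, h v hv⟩⟩
  · exact Or.inr ⟨he, fun v hv => mem_filter.2 ⟨hF e he hv, h v hv⟩⟩

/-- If some vertex cannot reach `y`, splitting `X` by reachability of `y` and applying sparsity to
both sides leaves at most |X| - 2 edges. A cycle would span as many edges as it has vertices. -/
lemma isTree_of_sparse (hg : T.IsEnds g) (hV : T.vertexSet = X) (hF : T.edgeSet = F)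
    (hs : Sparse 1 g F) (ht : Tight 1 g F X) : T.IsTree := by
  classical
  have hmem : ∀ e ∈ F, e ∈ T.edgeSet := fun e he => by rw [hF]; exact he
  have hsub : ∀ e ∈ F, g e ⊆ X := fun e he => by
    rw [← coe_subset, ← hV]
    exact hg.coe_subset_vertexSet (hmem e he)
  refine ⟨⟨by rw [hV]; exact ht.1, fun x hx y hy => ?_⟩, fun x p hp => ?_⟩
  · by_contra hcon
    have hR : ∀ e ∈ F, (∀ v ∈ g e, Nonempty (T.Walk v y)) ∨
        ∀ v ∈ g e, ¬ Nonempty (T.Walk v y) := by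
      intro e he
      obtain ⟨a, b, hab⟩ := exists_isLink_of_mem_edgeSet (hmem e he)
      rw [hg e a b hab]
      have h1 : Nonempty (T.Walk a y) → Nonempty (T.Walk b y) :=
        fun ⟨p⟩ => ⟨Walk.cons b e hab.symm p⟩
      have h2 : Nonempty (T.Walk b y) → Nonempty (T.Walk a y) :=
        fun ⟨p⟩ => ⟨Walk.cons a e hab p⟩
      simp only [mem_insert, mem_singleton, forall_eq_or_imp, forall_eq]
      tauto
    have h1 := card_le_card_inside_add hsub hR
    rw [hV] at hx hy
    have h2 := hs (X.filter fun v => Nonempty (T.Walk v y))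
      ⟨y, mem_filter.2 ⟨hy, ⟨Walk.nil y (by rw [hV]; exact hy)⟩⟩⟩
    have h3 := hs (X.filter fun v => ¬ Nonempty (T.Walk v y)) ⟨x, mem_filter.2 ⟨hx, hcon⟩⟩
    have h4 := ht.2
    have h5 := card_filter_add_card_filter_not (s := X) (fun v => Nonempty (T.Walk v y))
    rw [inside_eq_self hsub] at h4
    omega
  · obtain ⟨hne, htr, hnd⟩ := hp
    cases p with
    | nil => exact hne rfl
    | cons x e h p =>
      have hinc : ∀ e' ∈ (Walk.cons x e h p).edges, g e' ⊆ p.support.toFinset := by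
        intro e' he' v hv
        have he'T := Walk.mem_edgeSet_of_mem_edges _ e' he'
        have h2 := Walk.mem_support_of_inc _ e' he' v ((hg.mem_iff_inc he'T).1 hv)
        rw [List.mem_toFinset]
        rcases List.mem_cons.1 h2 with rfl | h2
        · exact p.end_mem_support
        · exact h2
      have h1 := hs p.support.toFinset ⟨x, List.mem_toFinset.2 p.end_mem_support⟩
      have h2 : (Walk.cons x e h p).edges.toFinset ⊆ inside g F p.support.toFinset := by
        intro e' he'
        rw [List.mem_toFinset] at he'
        refine mem_inside.2 ⟨?_, hinc e' he'⟩
        have := Walk.mem_edgeSet_of_mem_edges _ e' he'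
        rwa [hF] at this
      have h3 := card_le_card h2
      rw [List.toFinset_card_of_nodup htr] at h3
      have hnd' : p.support.Nodup := hnd
      rw [List.toFinset_card_of_nodup hnd', p.length_support] at h1
      simp only [Walk.edges, List.length_cons] at h3
      omega

lemma Walk.exists_link_leaving {A : Finset α} (p : T.Walk x y) (hx : x ∈ A) (hy : y ∉ A) :
    ∃ e a b, T.IsLink e a b ∧ a ∈ A ∧ b ∉ A ∧ a ∈ p.support ∧ b ∈ p.support := by
  induction p with
  | nil => exact absurd hx hy
  | @cons w z x e h p ih =>
    by_cases hw : w ∈ A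
    · obtain ⟨e', a, b, h1, h2, h3, h4, h5⟩ := ih hw hy
      exact ⟨e', a, b, h1, h2, h3, List.mem_cons_of_mem _ h4, List.mem_cons_of_mem _ h5⟩
    · exact ⟨e, x, w, h, hx, hw, by simp [support], by simp [support, p.start_mem_support]⟩

/-- A largest subset spanning at least its size minus one edges is everything, since an edge leaving
it would allow one more vertex. -/
lemma IsConnected.card_le (hT : T.IsConnected) (hg : T.IsEnds g) (hV : T.vertexSet = X)
    (hF : T.edgeSet = F) : #X ≤ #(inside g F X) + 1 := by
  obtain ⟨⟨r, hr⟩, hc⟩ := hT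
  rw [hV] at hr
  obtain ⟨A, hA, hmax⟩ := exists_max_image
    (X.powerset.filter fun A => A.Nonempty ∧ #A ≤ #(inside g F A) + 1) card
    ⟨{r}, by simpa using hr⟩
  simp only [mem_filter, mem_powerset] at hA hmax
  obtain ⟨hAX, ⟨a, ha⟩, hcard⟩ := hA
  suffices A = X by rwa [this] at hcard
  by_contra hne
  obtain ⟨b, hbX, hbA⟩ := exists_of_ssubset (hAX.ssubset_of_ne hne)
  obtain ⟨p⟩ := hc a (by rw [hV]; exact hAX ha) b (by rw [hV]; exact hbX)
  obtain ⟨e, u, v, he, hu, hv, -, -⟩ := p.exists_link_leaving ha hbA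
  have hvX : v ∈ X := by
    have := he.right_mem
    rwa [hV] at this
  have heF : e ∈ F := by
    have := he.edge_mem
    rwa [hF] at this
  have h1 : insert e (inside g F A) ⊆ inside g F (insert v A) := by
    refine insert_subset (mem_inside.2 ⟨heF, ?_⟩) (inside_mono subset_rfl (subset_insert _ _))
    rw [hg e u v he, insert_subset_iff, singleton_subset_iff]
    exact ⟨mem_insert_of_mem hu, mem_insert_self _ _⟩
  have h2 := card_le_card h1
  rw [card_insert_of_notMem] at h2
  · have h3 := hmax (insert v A) ⟨insert_subset hvX hAX, insert_nonempty _ _, by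
      rw [card_insert_of_notMem hv]; omega⟩
    rw [card_insert_of_notMem hv] at h3
    omega
  · intro h
    have := (mem_inside.1 h).2
    rw [hg e u v he, insert_subset_iff, singleton_subset_iff] at this
    exact hv this.2

/-- Removing an edge `xy` separates `x` from `y`, as a remaining path would close a cycle; induction
applies to both sides. -/
lemma card_lt_of_acyclic (hT : ∀ (x : α) (p : T.Walk x x), ¬ p.IsCycle) (hg : T.IsEnds g)
    (hX : X.Nonempty) (hF : ∀ e ∈ F, e ∈ T.edgeSet ∧ g e ⊆ X) : #F + 1 ≤ #X := by
  classical
  induction hn : #F using Nat.strong_induction_on generalizing F X with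
  | _ n ih =>
  rcases F.eq_empty_or_nonempty with rfl | ⟨e, he⟩
  · rw [card_empty] at hn
    have := card_pos.2 hX
    omega
  obtain ⟨x, y, hxy⟩ := exists_isLink_of_mem_edgeSet (hF e he).1
  have hsub : ({x, y} : Finset α) ⊆ X := by
    rw [← hg e x y hxy]
    exact (hF e he).2
  rw [insert_subset_iff, singleton_subset_iff] at hsub
  set R : α → Prop := fun v => ∃ p : T.Walk v y, ∀ e' ∈ p.edges, e' ∈ F.erase e with hRdef
  have hR : ∀ e' ∈ F.erase e, (∀ v ∈ g e', R v) ∨ ∀ v ∈ g e', ¬ R v := by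
    intro e' he'
    obtain ⟨a, b, hab⟩ := exists_isLink_of_mem_edgeSet (hF e' (mem_of_mem_erase he')).1
    rw [hg e' a b hab]
    have key : ∀ a b, T.IsLink e' a b → R a → R b := by
      rintro a b hab ⟨p, hp⟩
      refine ⟨Walk.cons b e' hab.symm p, fun c hc => ?_⟩
      rcases List.mem_cons.1 hc with rfl | hc
      · exact he'
      · exact hp c hc
    have h1 := key a b hab
    have h2 := key b a hab.symm
    simp only [mem_insert, mem_singleton, forall_eq_or_imp, forall_eq]
    tauto
  have hy : R y := ⟨Walk.nil y hxy.right_mem, by simp [Walk.edges]⟩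
  have hx : ¬ R x := by
    rintro ⟨p, hp⟩
    obtain ⟨q, hq, hqp⟩ := p.exists_path
    refine hT y (Walk.cons y e hxy.symm q) ⟨by simp [Walk.edges], ?_, hq⟩
    exact List.nodup_cons.2 ⟨fun h => (mem_erase.1 (hp e (hqp h))).1 rfl,
      q.isTrail_of_nodup_support hq⟩
  have h1 := card_le_card_inside_add
    (fun e' he' => (hF e' (mem_of_mem_erase he')).2) hR
  have hcard := card_erase_of_mem he
  have hpos := card_pos.2 ⟨e, he⟩
  have hlt : ∀ Y, #(inside g (F.erase e) Y) < n := fun Y => by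
    have := card_le_card (filter_subset (fun e => g e ⊆ Y) (F.erase e))
    rw [inside]
    omega
  have hin : ∀ Y, ∀ e' ∈ inside g (F.erase e) Y, e' ∈ T.edgeSet ∧ g e' ⊆ Y := fun Y e' he' => by
    rw [mem_inside, mem_erase] at he'
    exact ⟨(hF e' he'.1.2).1, he'.2⟩
  have h2 := ih _ (hlt _) (X := X.filter R) ⟨y, mem_filter.2 ⟨hsub.2, hy⟩⟩ (hin _) rfl
  have h3 := ih _ (hlt _) (X := X.filter fun v => ¬ R v) ⟨x, mem_filter.2 ⟨hsub.1, hx⟩⟩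
    (hin _) rfl
  have h4 := card_filter_add_card_filter_not (s := X) R
  omega

lemma IsTree.sparse_tight (hT : T.IsTree) (hg : T.IsEnds g) (hV : T.vertexSet = X)
    (hF : T.edgeSet = F) : Sparse 1 g F ∧ Tight 1 g F X := by
  have hs : Sparse 1 g F := fun Y hY => by
    have := card_lt_of_acyclic hT.2 hg hY (F := inside g F Y) fun e he => by
      rw [mem_inside] at he
      refine ⟨?_, he.2⟩
      rw [hF]
      exact he.1
    omega
  have hne : X.Nonempty := by
    have := hT.1.1
    rwa [hV] at this
  have h1 := hs X hne
  have h2 := hT.1.card_le hg hV hF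
  exact ⟨hs, hne, by omega⟩

lemma IsTreeConnected.exists_forests (hG : IsTreeConnected 2 G) (hg : G.IsEnds g)
    (hV : G.vertexSet = X) (hE : G.edgeSet.Finite) :
    ∃ F₁ F₂ : Finset β, (F₁ : Set β) ⊆ G.edgeSet ∧ (F₂ : Set β) ⊆ G.edgeSet ∧ Disjoint F₁ F₂ ∧
      Sparse 1 g F₁ ∧ Tight 1 g F₁ X ∧ Sparse 1 g F₂ ∧ Tight 1 g F₂ X := by
  obtain ⟨T, hT, hdis⟩ := hG
  have hsub : ∀ i, (T i).edgeSet ⊆ G.edgeSet := fun i => (hT i).1.le.edgeSet_mono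
  have hfin : ∀ i, (T i).edgeSet.Finite := fun i => hE.subset (hsub i)
  have h : ∀ i, Sparse 1 g (hfin i).toFinset ∧ Tight 1 g (hfin i).toFinset X := fun i =>
    (hT i).2.sparse_tight (hg.mono (hT i).1.le) ((hT i).1.vertexSet_eq.trans hV) (by simp)
  refine ⟨(hfin 0).toFinset, (hfin 1).toFinset, by simpa using hsub 0, by simpa using hsub 1, ?_,
    (h 0).1, (h 0).2, (h 1).1, (h 1).2⟩
  rw [← disjoint_coe]
  simpa using hdis 0 1 (by decide)

/-- Two forests with at most |X| - 1 edges each share 2(|X| - 1) edges, so both attain the bound and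
are spanning trees. -/
lemma isTreeConnected_of_tight [G.Loopless] (hg : G.IsEnds g) (hV : G.vertexSet = X)
    {B : Finset β} (hBE : (B : Set β) ⊆ G.edgeSet) (hB : Sparse 2 g B) (hX : Tight 2 g B X) :
    IsTreeConnected 2 G ∧ ∃ F₁ F₂, F₁ ∪ F₂ = B ∧ Disjoint F₁ F₂ ∧
      (G.restrict F₁).IsTree ∧ (G.restrict F₂).IsTree := by
  have hE : ∀ e ∈ B, g e ⊆ X ∧ #(g e) = 2 := fun e he => by
    refine ⟨?_, hg.card_eq (hBE he)⟩
    rw [← coe_subset, ← hV]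
    exact hg.coe_subset_vertexSet (hBE he)
  obtain ⟨F₁, F₂, hU, hd, h1, h2⟩ := hB.exists_forests hE
  have hc : ∀ F ⊆ B, inside g F X = F := fun F hF => inside_eq_self fun e he => (hE e (hF he)).1
  have hF₁ : F₁ ⊆ B := hU ▸ subset_union_left
  have hF₂ : F₂ ⊆ B := hU ▸ subset_union_right
  have h3 := h1 X hX.1
  have h4 := h2 X hX.1
  have h5 := hX.2
  have h6 := card_union_of_disjoint hd
  rw [hU] at h6
  rw [hc _ hF₁] at h3
  rw [hc _ hF₂] at h4
  rw [hc _ subset_rfl] at h5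
  have key : ∀ F ⊆ B, Sparse 1 g F → #F + 1 = 1 * #X → (G.restrict F).IsTree := by
    intro F hF hs hcard
    refine isTree_of_sparse (hg.mono restrict_le) (X := X) (F := F) hV ?_ hs ⟨hX.1, ?_⟩
    · rw [edgeSet_restrict]
      exact Set.inter_eq_right.2 (fun e he => hBE (hF he))
    · rw [hc F hF]
      exact hcard
  have hT₁ := key F₁ hF₁ h1 (by omega)
  have hT₂ := key F₂ hF₂ h2 (by omega)
  have hdis : Disjoint (G.restrict F₁).edgeSet (G.restrict F₂).edgeSet := by
    simp only [edgeSet_restrict]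
    exact (disjoint_coe.2 hd).mono Set.inter_subset_right Set.inter_subset_right
  refine ⟨⟨![G.restrict F₁, G.restrict F₂], fun i => ?_, fun i j hij => ?_⟩,
    F₁, F₂, hU, hd, hT₁, hT₂⟩
  · fin_cases i
    · exact ⟨⟨restrict_le, rfl⟩, hT₁⟩
    · exact ⟨⟨restrict_le, rfl⟩, hT₂⟩
  · fin_cases i <;> fin_cases j
    · exact absurd rfl hij
    · exact hdis
    · exact hdis.symm
    · exact absurd rfl hij

end Graph

/-! ### Maximal tight sets -/

namespace EdgeCount

variable {α β : Type*} [DecidableEq α] [DecidableEq β]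
variable {g : β → Finset α} {B E : Finset β} {X V C D : Finset α}

open Classical in
/-- The maximal tight subsets of `V`. -/
noncomputable def components (g : β → Finset α) (B : Finset β) (V : Finset α) :
    Finset (Finset α) :=
  V.powerset.filter (Maximal fun X => X ⊆ V ∧ Tight 2 g B X)

lemma mem_components : C ∈ components g B V ↔ Maximal (fun X => X ⊆ V ∧ Tight 2 g B X) C := by
  simp only [components, mem_filter, mem_powerset, and_iff_right_iff_imp]
  exact fun h => h.prop.1

lemma exists_component (hXV : X ⊆ V) (hX : Tight 2 g B X) : ∃ C ∈ components g B V, X ⊆ C := by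
  have hfin : {X | X ⊆ V ∧ Tight 2 g B X}.Finite :=
    (V.powerset.finite_toSet).subset fun X hX => by simpa using hX.1
  obtain ⟨C, hXC, hC⟩ := hfin.exists_le_maximal (show X ∈ {X | X ⊆ V ∧ Tight 2 g B X} from ⟨hXV, hX⟩)
  exact ⟨C, mem_components.2 hC, hXC⟩

lemma eq_of_mem_components (hB : Sparse 2 g B) (hC : C ∈ components g B V)
    (hD : D ∈ components g B V) (hCD : (C ∩ D).Nonempty) : C = D := by
  rw [mem_components] at hC hD
  have h : C ∪ D ⊆ V ∧ Tight 2 g B (C ∪ D) :=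
    ⟨union_subset hC.prop.1 hD.prop.1, (hC.prop.2.union_inter hB hD.prop.2 hCD).1⟩
  exact (hC.eq_of_le h subset_union_left).trans
    (hD.eq_of_le h subset_union_right).symm

lemma pairwiseDisjoint_components (hB : Sparse 2 g B) :
    (components g B V : Set (Finset α)).PairwiseDisjoint id := by
  intro C hC D hD hCD
  by_contra hcon
  rw [Function.onFun, disjoint_iff_inter_eq_empty, ← ne_eq, ← nonempty_iff_ne_empty] at hcon
  exact hCD (eq_of_mem_components hB hC hD hcon)

lemma card_biUnion_inside (hB : Sparse 2 g B) (h2 : ∀ e ∈ B, #(g e) = 2)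
    {Q : Finset (Finset α)} (hQ : Q ⊆ components g B V) :
    #(Q.biUnion (inside g B)) = ∑ C ∈ Q, #(inside g B C) := by
  refine card_biUnion fun C hC D hD hCD => disjoint_left.2 ?_
  intro e heC heD
  rw [mem_inside] at heC heD
  obtain ⟨a, ha⟩ : (g e).Nonempty := card_pos.1 (by rw [h2 e heC.1]; omega)
  exact hCD (eq_of_mem_components hB (hQ hC) (hQ hD)
    ⟨a, mem_inter.2 ⟨heC.2 ha, heD.2 ha⟩⟩)

/-- The edges of `B` that no maximal tight set spans. -/
noncomputable def cross (g : β → Finset α) (B : Finset β) (V : Finset α) : Finset β :=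
  B.filter fun e => ∀ C ∈ components g B V, ¬ g e ⊆ C

lemma mem_cross {e : β} : e ∈ cross g B V ↔ e ∈ B ∧ ∀ C ∈ components g B V, ¬ g e ⊆ C := by
  simp [cross]

lemma sum_card_inside_components {Q : Finset (Finset α)}
    (hQ : Q ⊆ components g B V) :
    ∑ C ∈ Q, #(inside g B C) + 2 * #Q = 2 * ∑ C ∈ Q, #C := by
  rw [mul_sum, mul_comm, ← smul_eq_mul, ← sum_const, ← sum_add_distrib]
  exact sum_congr rfl fun C hC => (mem_components.1 (hQ hC)).prop.2.2

/-- The maximal tight sets partition `V`, because singletons are tight and intersecting tight sets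
merge. Each `C` contributes 2|C| - 2 edges, and the rest of `B` is crossing. -/
lemma card_add_two_mul_card_components (hE : ∀ e ∈ B, g e ⊆ V ∧ #(g e) = 2)
    (hB : Sparse 2 g B) :
    #B + 2 * #(components g B V) = 2 * #V + #(cross g B V) := by
  have h1 : B = (components g B V).biUnion (inside g B) ∪ cross g B V := by
    ext e
    simp only [mem_union, mem_biUnion, mem_inside, mem_cross]
    constructor
    · intro he
      by_cases h : ∃ C ∈ components g B V, g e ⊆ C
      · obtain ⟨C, hC, h⟩ := h
        exact Or.inl ⟨C, hC, he, h⟩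
      · push Not at h
        exact Or.inr ⟨he, h⟩
    · rintro (⟨C, -, he, -⟩ | ⟨he, -⟩) <;> exact he
  have h2 : Disjoint ((components g B V).biUnion (inside g B)) (cross g B V) := by
    rw [disjoint_left]
    intro e he he'
    obtain ⟨C, hC, heC⟩ := mem_biUnion.1 he
    exact (mem_cross.1 he').2 C hC (mem_inside.1 heC).2
  have h3 := card_union_of_disjoint h2
  rw [← h1, card_biUnion_inside hB (fun e he => (hE e he).2) subset_rfl] at h3
  have h4 := sum_card_inside_components (subset_refl (components g B V))
  have h5 : (components g B V).biUnion id = V := by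
    ext v
    simp only [mem_biUnion, id]
    refine ⟨fun ⟨C, hC, hv⟩ => (mem_components.1 hC).prop.1 hv, fun hv => ?_⟩
    obtain ⟨C, hC, hvC⟩ := exists_component (V := V) (singleton_subset_iff.2 hv)
      (tight_singleton (k := 2) (fun e he => (hE e he).2) v)
    exact ⟨C, hC, hvC (mem_singleton_self v)⟩
  have h6 := card_biUnion (pairwiseDisjoint_components hB (V := V))
  rw [h5] at h6
  simp only [id] at h6
  omega

/-- A vertex set that carries two edge-disjoint spanning trees lies inside one maximal tight set,
provided that `B` contains all edges which its tight sets do not span. -/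
lemma exists_component_of_forests (hE : ∀ e ∈ E, g e ⊆ V ∧ #(g e) = 2) (hBE : B ⊆ E)
    (hB : Sparse 2 g B) (hcl : ∀ e ∈ E, e ∈ B ∨ ∃ Y ⊆ V, Tight 2 g B Y ∧ g e ⊆ Y) (hXV : X ⊆ V)
    {F₁ F₂ : Finset β} (hF₁ : F₁ ⊆ E) (hF₂ : F₂ ⊆ E) (hd : Disjoint F₁ F₂)
    (hs₁ : Sparse 1 g F₁) (ht₁ : Tight 1 g F₁ X) (hs₂ : Sparse 1 g F₂) (ht₂ : Tight 1 g F₂ X) :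
    ∃ C ∈ components g B V, X ⊆ C := by
  have h2 : ∀ e ∈ B, #(g e) = 2 := fun e he => (hE e (hBE he)).2
  set Q := (components g B V).filter (fun C => (C ∩ X).Nonempty) with hQdef
  have hQ : Q ⊆ components g B V := filter_subset _ _
  set cr := inside g (cross g B V) X with hcr
  have hXD : X ⊆ Q.biUnion id := fun v hv => by
    obtain ⟨C, hC, hvC⟩ := exists_component (V := V) (singleton_subset_iff.2 (hXV hv))
      (tight_singleton (k := 2) h2 v)
    have hvC' := hvC (mem_singleton_self v)
    exact mem_biUnion.2 ⟨C, mem_filter.2 ⟨hC, v, mem_inter.2 ⟨hvC', hv⟩⟩, hvC'⟩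
  have hsub : Q.biUnion (inside g B) ∪ cr ⊆ inside g B (Q.biUnion id) := by
    refine union_subset (fun e he => ?_) ?_
    · obtain ⟨C, hC, heC⟩ := mem_biUnion.1 he
      exact inside_mono subset_rfl (subset_biUnion_of_mem id hC) heC
    · exact inside_mono (filter_subset _ _) hXD
  have hdis : Disjoint (Q.biUnion (inside g B)) cr := by
    rw [disjoint_left]
    intro e he he'
    obtain ⟨C, hC, heC⟩ := mem_biUnion.1 he
    exact (mem_cross.1 (mem_inside.1 he').1).2 C (hQ hC) (mem_inside.1 heC).2
  have h3 := card_le_card hsub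
  rw [card_union_of_disjoint hdis, card_biUnion_inside hB h2 hQ] at h3
  have h4 := sum_card_inside_components hQ
  have h5 : ∑ C ∈ Q, #(C ∩ X) ≤ #X := by
    rw [← card_biUnion]
    · exact card_le_card (biUnion_subset.2 fun C _ => inter_subset_right)
    · intro C hC D hD hCD
      exact (pairwiseDisjoint_components hB (hQ hC) (hQ hD) hCD).mono
        inter_subset_left inter_subset_left
  -- A spanning tree of `X` needs at least |Q| - 1 edges between the parts that `X` meets, and `hcl`
  -- puts these edges in `B`.
  have key : ∀ F ⊆ E, Sparse 1 g F → Tight 1 g F X → #Q ≤ #(F ∩ cr) + 1 := by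
    intro F hFE hs ht
    have h6 : inside g F X ⊆ Q.biUnion (fun C => inside g F (C ∩ X)) ∪ F ∩ cr := by
      intro e he
      rw [mem_inside] at he
      rw [mem_union, mem_biUnion]
      by_cases h : ∃ C ∈ components g B V, g e ⊆ C
      · obtain ⟨C, hC, heC⟩ := h
        have hsub := subset_inter heC he.2
        have hne : (g e).Nonempty := card_pos.1 (by rw [(hE e (hFE he.1)).2]; omega)
        exact Or.inl ⟨C, mem_filter.2 ⟨hC, hne.mono hsub⟩, mem_inside.2 ⟨he.1, hsub⟩⟩
      · push Not at h
        refine Or.inr (mem_inter.2 ⟨he.1, mem_inside.2 ⟨mem_cross.2 ⟨?_, h⟩, he.2⟩⟩)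
        refine (hcl e (hFE he.1)).resolve_right ?_
        rintro ⟨Y, hYV, hY, heY⟩
        obtain ⟨C, hC, hYC⟩ := exists_component hYV hY
        exact h C hC (heY.trans hYC)
    have h7 := (card_le_card h6).trans (card_union_le _ _)
    have h8 := card_biUnion_le (s := Q) (t := fun C => inside g F (C ∩ X))
    have h9 : ∑ C ∈ Q, #(inside g F (C ∩ X)) + #Q ≤ ∑ C ∈ Q, #(C ∩ X) := by
      rw [card_eq_sum_ones, ← sum_add_distrib]
      exact sum_le_sum fun C hC => by
        have := hs (C ∩ X) (mem_filter.1 hC).2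
        omega
    have := ht.2
    omega
  have h6 := key F₁ hF₁ hs₁ ht₁
  have h7 := key F₂ hF₂ hs₂ ht₂
  have h8 : #(F₁ ∩ cr) + #(F₂ ∩ cr) ≤ #cr := by
    rw [← card_union_of_disjoint (hd.mono inter_subset_left inter_subset_left)]
    exact card_le_card (union_subset inter_subset_right inter_subset_right)
  have h9 := card_biUnion_le (s := Q) (t := id)
  simp only [id] at h9
  have hne : (Q.biUnion id).Nonempty := ht₁.1.mono hXD
  have h10 := hB _ hne
  -- The disjoint trees give 2|Q| - 2 crossing edges of `B`, exactly what is missing for the union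
  -- of the parts to be tight.
  have htight : Tight 2 g B (Q.biUnion id) := ⟨hne, by omega⟩
  obtain ⟨C, hC, hDC⟩ := exists_component (V := V)
    (biUnion_subset.2 fun C hC => (mem_components.1 (hQ hC)).prop.1) htight
  exact ⟨C, hC, hXD.trans hDC⟩

end EdgeCount

/-! ### 2-tree-connected components and Ω in terms of a sparse edge set -/

namespace Graph

open EdgeCount

variable {α β : Type*} {G : Graph α β} [DecidableEq α] [DecidableEq β]
variable {g : β → Finset α} {B E : Finset β} {X V : Finset α}

lemma IsEnds.mem_edgeSet_induce (hg : G.IsEnds g) {e : β} :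
    e ∈ (G.induce X).edgeSet ↔ e ∈ G.edgeSet ∧ g e ⊆ X := by
  rw [edgeSet_induce]
  constructor
  · rintro ⟨x, y, h, hx, hy⟩
    refine ⟨h.edge_mem, ?_⟩
    rw [hg e x y h, insert_subset_iff, singleton_subset_iff]
    exact ⟨hx, hy⟩
  · rintro ⟨he, heX⟩
    obtain ⟨x, y, h⟩ := exists_isLink_of_mem_edgeSet he
    rw [hg e x y h, insert_subset_iff, singleton_subset_iff] at heX
    exact ⟨x, y, h, heX⟩

lemma IsEnds.induce (hg : G.IsEnds g) : (G.induce X).IsEnds g :=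
  fun e x y h => hg e x y h.1

lemma loopless_induce [G.Loopless] : (G.induce (X : Set α)).Loopless :=
  ⟨fun e x h => G.not_isLoopAt e x h.1⟩

/-- Tight sets induce 2-tree-connected subgraphs by `isTreeConnected_of_tight`; conversely,
`exists_component_of_forests` puts any vertex set inducing such a subgraph inside one maximal tight
set. So the maximal sets on both sides agree. -/
lemma treeComponents_eq [G.Loopless] (hg : G.IsEnds g) (hV : G.vertexSet = V)
    (hE : G.edgeSet = E) (hBE : B ⊆ E) (hB : Sparse 2 g B)
    (hcl : ∀ e ∈ E, e ∈ B ∨ ∃ Y ⊆ V, Tight 2 g B Y ∧ g e ⊆ Y) :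
    treeComponents 2 G = (fun C : Finset α => (C : Set α)) '' components g B V := by
  have hgE : ∀ e ∈ E, g e ⊆ V ∧ #(g e) = 2 := fun e he => by
    have heG : e ∈ G.edgeSet := by rw [hE]; exact he
    refine ⟨?_, hg.card_eq heG⟩
    rw [← coe_subset, ← hV]
    exact hg.coe_subset_vertexSet heG
  have h1 : ∀ C ∈ components g B V, IsTreeConnected 2 (G.induce (C : Set α)) := by
    intro C hC
    have hC' := (mem_components.1 hC).prop.2
    have := loopless_induce (G := G) (X := C)
    refine (isTreeConnected_of_tight hg.induce (X := C) rfl (B := inside g B C) ?_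
      (hB.mono (filter_subset _ _)) ⟨hC'.1, ?_⟩).1
    · intro e he
      have he' := mem_inside.1 he
      refine hg.mem_edgeSet_induce.2 ⟨?_, he'.2⟩
      rw [hE]
      exact hBE he'.1
    · rw [inside_eq_self fun e he => (mem_inside.1 he).2]
      exact hC'.2
  have h2 : ∀ X : Set α, X ⊆ G.vertexSet → IsTreeConnected 2 (G.induce X) →
      ∃ C ∈ components g B V, X ⊆ C := by
    intro X hXV hX
    rw [hV] at hXV
    lift X to Finset α using V.finite_toSet.subset hXV
    have hsub : (G.induce (X : Set α)).edgeSet ⊆ E := fun e he => by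
      rw [← hE]
      exact (hg.mem_edgeSet_induce.1 he).1
    obtain ⟨F₁, F₂, hF₁, hF₂, hd, hs₁, ht₁, hs₂, ht₂⟩ := hX.exists_forests hg.induce rfl
      (E.finite_toSet.subset hsub)
    obtain ⟨C, hC, hXC⟩ := exists_component_of_forests hgE hBE hB hcl (coe_subset.1 hXV)
      (coe_subset.1 (hF₁.trans hsub)) (coe_subset.1 (hF₂.trans hsub)) hd hs₁ ht₁ hs₂ ht₂
    exact ⟨C, hC, coe_subset.2 hXC⟩
  have hCV : ∀ C ∈ components g B V, (C : Set α) ⊆ G.vertexSet := fun C hC => by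
    rw [hV]
    exact coe_subset.2 (mem_components.1 hC).prop.1
  ext X
  constructor
  · intro hX
    rw [treeComponents, Set.mem_ofPred_eq] at hX
    obtain ⟨C, hC, hXC⟩ := h2 X hX.prop.1 hX.prop.2
    exact ⟨C, hC, (hX.eq_of_le ⟨hCV C hC, h1 C hC⟩ hXC).symm⟩
  · rintro ⟨C, hC, rfl⟩
    refine ⟨⟨hCV C hC, h1 C hC⟩, fun Y hY hCY => ?_⟩
    obtain ⟨D, hD, hYD⟩ := h2 Y hY.1 hY.2
    have hCD : C ⊆ D := coe_subset.1 (hCY.trans hYD)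
    have := (mem_components.1 hC).eq_of_le (mem_components.1 hD).prop hCD
    subst this
    exact hYD

/-- By `hcl`, edges outside `B` stay within one component, so the crossing edges of `G` are those of
`B`, and the count of `B` over its components gives the formula. -/
lemma two_mul_treeOmega [G.Loopless] (hg : G.IsEnds g) (hV : G.vertexSet = V)
    (hE : G.edgeSet = E) (hBE : B ⊆ E) (hB : Sparse 2 g B)
    (hcl : ∀ e ∈ E, e ∈ B ∨ ∃ Y ⊆ V, Tight 2 g B Y ∧ g e ⊆ Y) :
    2 * treeOmega 2 G = 2 * (#V : ℝ) - #B := by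
  have hgE : ∀ e ∈ E, g e ⊆ V ∧ #(g e) = 2 := fun e he => by
    have heG : e ∈ G.edgeSet := by rw [hE]; exact he
    refine ⟨?_, hg.card_eq heG⟩
    rw [← coe_subset, ← hV]
    exact hg.coe_subset_vertexSet heG
  have hcomp := treeComponents_eq hg hV hE hBE hB hcl
  have h1 : (treeComponents 2 G).ncard = #(components g B V) := by
    rw [hcomp, Set.ncard_image_of_injective _ coe_injective, Set.ncard_coe_finset]
  have h2 : G.crossEdges (treeComponents 2 G) = #(cross g B V) := by
    rw [crossEdges, ← Set.ncard_coe_finset]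
    congr 1
    ext e
    rw [hcomp]
    simp only [Set.mem_ofPred_eq, mem_coe, mem_cross, Set.exists_mem_image]
    constructor
    · rintro ⟨x, y, hxy, C, hC, D, hD, hCD, hx, hy⟩
      have heE : e ∈ E := by
        have := hxy.edge_mem
        rwa [hE] at this
      have hno : ∀ A ∈ components g B V, ¬ g e ⊆ A := by
        intro A hA hsub
        rw [hg e x y hxy, insert_subset_iff, singleton_subset_iff] at hsub
        refine hCD ?_
        rw [eq_of_mem_components hB hC hA ⟨x, mem_inter.2 ⟨hx, hsub.1⟩⟩,
          eq_of_mem_components hB hD hA ⟨y, mem_inter.2 ⟨hy, hsub.2⟩⟩]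
      refine ⟨(hcl e heE).resolve_right ?_, hno⟩
      rintro ⟨Y, hYV, hY, heY⟩
      obtain ⟨A, hA, hYA⟩ := exists_component hYV hY
      exact hno A hA (heY.trans hYA)
    · rintro ⟨heB, hno⟩
      have heG : e ∈ G.edgeSet := by rw [hE]; exact hBE heB
      obtain ⟨x, y, hxy⟩ := exists_isLink_of_mem_edgeSet heG
      have hsub := (hgE e (hBE heB)).1
      rw [hg e x y hxy, insert_subset_iff, singleton_subset_iff] at hsub
      have hex : ∀ v ∈ V, ∃ C ∈ components g B V, v ∈ C := fun v hv => by
        obtain ⟨C, hC, hvC⟩ := exists_component (V := V) (singleton_subset_iff.2 hv)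
          (tight_singleton (k := 2) (fun e he => (hgE e (hBE he)).2) v)
        exact ⟨C, hC, hvC (mem_singleton_self v)⟩
      obtain ⟨C, hC, hxC⟩ := hex x hsub.1
      obtain ⟨D, hD, hyD⟩ := hex y hsub.2
      refine ⟨x, y, hxy, C, hC, D, hD, fun hCD => hno C hC ?_, hxC, hyD⟩
      rw [hg e x y hxy, insert_subset_iff, singleton_subset_iff]
      exact ⟨hxC, by rw [coe_injective hCD]; exact hyD⟩
  have h3 := card_add_two_mul_card_components (fun e he => hgE e (hBE he)) hB
  have h4 : (#B : ℝ) + 2 * #(components g B V) = 2 * #V + #(cross g B V) := by exact_mod_cast h3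
  rw [treeOmega, h1, h2]
  push_cast
  linarith

end Graph

/-! ### Degree counts -/

namespace EdgeCount

variable {α β : Type*} [DecidableEq α] [DecidableEq β] {g : β → Finset α} {B L P : Finset β}

lemma deg_mono (h : L ⊆ B) (v : α) : deg g L v ≤ deg g B v :=
  card_le_card (filter_subset_filter _ h)

lemma deg_symmDiff (v : α) :
    deg g (symmDiff L P) v + 2 * deg g (L ∩ P) v = deg g L v + deg g P v := by
  unfold deg
  have h1 : (symmDiff L P).filter (fun e => v ∈ g e)
      = (L.filter (fun e => v ∈ g e) \ P.filter (fun e => v ∈ g e)) ∪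
        (P.filter (fun e => v ∈ g e) \ L.filter (fun e => v ∈ g e)) := by
    ext e
    simp only [mem_filter, mem_symmDiff, mem_union, mem_sdiff]
    tauto
  rw [h1, card_union_of_disjoint, filter_inter_distrib]
  · have h2 := card_sdiff_add_card_inter
      (L.filter (fun e => v ∈ g e)) (P.filter (fun e => v ∈ g e))
    have h3 := card_sdiff_add_card_inter
      (P.filter (fun e => v ∈ g e)) (L.filter (fun e => v ∈ g e))
    rw [inter_comm] at h3
    omega
  · rw [disjoint_left]
    intro e he he'
    exact (mem_sdiff.1 he).2 (mem_sdiff.1 he').1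

/-- The edges that avoid `S` are counted by the degrees on `S`. -/
lemma card_avoiding_add_sum_deg (hB : ∀ e ∈ B, #(g e) = 2) (S : Finset α) :
    #(B.filter fun e => Disjoint (g e) S) + ∑ v ∈ S, deg g B v = #B + #(inside g B S) := by
  have h := sum_card_bipartiteAbove_eq_sum_card_bipartiteBelow (s := S) (t := B)
    (fun v e => v ∈ g e)
  simp only [bipartiteAbove, bipartiteBelow] at h
  unfold deg
  rw [h, inside, card_filter, card_filter, ← sum_add_distrib, card_eq_sum_ones, ← sum_add_distrib]
  refine sum_congr rfl fun e he => ?_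
  rw [filter_mem_eq_inter]
  obtain ⟨x, y, hxy, he⟩ := card_eq_two.1 (hB e he)
  simp only [he, insert_subset_iff, singleton_subset_iff, disjoint_insert_left,
    disjoint_singleton_left]
  by_cases hx : x ∈ S <;> by_cases hy : y ∈ S
  · rw [inter_eq_right.2 (by simp [insert_subset_iff, hx, hy])]
    simp [hx, hy, card_pair hxy]
  · have : S ∩ {x, y} = {x} := by
      ext z
      simp only [mem_inter, mem_insert, mem_singleton]
      refine ⟨?_, by rintro rfl; exact ⟨hx, Or.inl rfl⟩⟩
      rintro ⟨hz, rfl | rfl⟩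
      · rfl
      · exact absurd hz hy
    simp [this, hx, hy]
  · have : S ∩ {x, y} = {y} := by
      ext z
      simp only [mem_inter, mem_insert, mem_singleton]
      refine ⟨?_, by rintro rfl; exact ⟨hy, Or.inr rfl⟩⟩
      rintro ⟨hz, rfl | rfl⟩
      · exact absurd hz hx
      · rfl
    simp [this, hx, hy]
  · have : S ∩ {x, y} = ∅ := by
      rw [← disjoint_iff_inter_eq_empty, disjoint_insert_right, disjoint_singleton_right]
      exact ⟨hx, hy⟩
    simp [this, hx, hy]

end EdgeCount

/-! ### Even subgraphs and closed trails -/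

namespace Graph

open EdgeCount

variable {α β : Type*} {G : Graph α β} {x y z : α}

namespace Walk

/-- The concatenation of two walks. -/
def append : {x y z : α} → G.Walk x y → G.Walk y z → G.Walk x z
  | _, _, _, nil _ _, q => q
  | _, _, _, cons x e h p, q => cons x e h (p.append q)

lemma edges_append (p : G.Walk x y) (q : G.Walk y z) :
    (p.append q).edges = p.edges ++ q.edges := by
  induction p with
  | nil => rfl
  | cons x e h p ih => simp [append, edges, ih]

lemma exists_split (p : G.Walk x y) (hz : z ∈ p.support) :
    ∃ (q : G.Walk x z) (r : G.Walk z y), p.edges = q.edges ++ r.edges := by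
  induction p with
  | nil x hx =>
    simp only [support, List.mem_singleton] at hz
    subst hz
    exact ⟨nil z hx, nil z hx, rfl⟩
  | cons x e h p ih =>
    rcases List.mem_cons.1 hz with rfl | hz
    · exact ⟨nil z h.left_mem, cons z e h p, rfl⟩
    · obtain ⟨q, r, hqr⟩ := ih hz
      exact ⟨cons x e h q, r, by simp [edges, hqr]⟩

lemma exists_rotate (p : G.Walk x x) (hz : z ∈ p.support) :
    ∃ q : G.Walk z z, q.edges.Perm p.edges := by
  obtain ⟨q, r, h⟩ := p.exists_split hz
  refine ⟨r.append q, ?_⟩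
  rw [edges_append, h]
  exact List.perm_append_comm

variable [DecidableEq α] {g : β → Finset α}

/-- Each passage of a walk through `v` uses two edges at `v`. -/
lemma countP_edges_add [G.Loopless] (hg : G.IsEnds g) (p : G.Walk x y) (v : α) :
    p.edges.countP (fun e => v ∈ g e) + (if x = v then 1 else 0) + (if y = v then 1 else 0)
      = 2 * p.support.count v := by
  induction p with
  | nil x hx => by_cases h : x = v <;> simp [edges, support, h]
  | @cons w z x e h p ih =>
    have hne : x ≠ w := h.ne
    have h1 : (if v ∈ g e then 1 else 0)
        = (if x = v then 1 else 0) + (if w = v then 1 else 0) := by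
      rw [hg e x w h]
      by_cases hx : x = v
      · subst hx
        simp [hne.symm]
      · by_cases hw : w = v
        · subst hw
          simp [hx]
        · simp [hx, hw, Ne.symm hx, Ne.symm hw]
    simp only [edges, support, List.countP_cons, List.count_cons, decide_eq_true_eq, beq_iff_eq]
    omega

lemma visits_eq (p : G.Walk x x) (v : α) : p.visits v = p.cyclicSupport.count v := by
  unfold visits
  congr
  exact Subsingleton.elim _ _

variable [DecidableEq β]

lemma deg_edges_add [G.Loopless] (hg : G.IsEnds g) (p : G.Walk x y) (hp : p.IsTrail) (v : α) :
    deg g p.edges.toFinset v + (if x = v then 1 else 0) + (if y = v then 1 else 0)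
      = 2 * p.support.count v := by
  have h : p.edges.toFinset.filter (fun e => v ∈ g e)
      = (p.edges.filter fun e => v ∈ g e).toFinset := by
    ext e
    simp
  rw [← p.countP_edges_add hg v, deg, h, List.toFinset_card_of_nodup (hp.filter _),
    List.countP_eq_length_filter]

end Walk

variable [DecidableEq α] [DecidableEq β] {g : β → Finset α} {V : Finset α} {F₁ F₂ B L : Finset β}

/-- Two edge-disjoint connected spanning subgraphs contain a connected spanning subgraph all of
whose degrees are even. -/
lemma exists_even_between [G.Loopless] (hg : G.IsEnds g) (hV : G.vertexSet = V)
    (hF : ((F₁ ∪ F₂ : Finset β) : Set β) ⊆ G.edgeSet) (hd : Disjoint F₁ F₂)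
    (hc : (G.restrict F₂).IsConnected) :
    ∃ L, F₁ ⊆ L ∧ L ⊆ F₁ ∪ F₂ ∧ ∀ v ∈ V, Even (deg g L v) := by
  -- Take `L` with the fewest vertices of odd degree. Odd vertices come in pairs, and toggling a
  -- path of `F₂` between two of them changes parity only there, while `F₁` is untouched.
  obtain ⟨L, hL, hmin⟩ := exists_min_image
    ((F₁ ∪ F₂).powerset.filter fun L => F₁ ⊆ L) (fun L => #(V.filter fun v => ¬ Even (deg g L v)))
    ⟨F₁, mem_filter.2 ⟨mem_powerset.2 subset_union_left, subset_rfl⟩⟩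
  simp only [mem_filter, mem_powerset] at hL hmin
  refine ⟨L, hL.2, hL.1, ?_⟩
  by_contra! hcon
  obtain ⟨x, hxV, hx⟩ := hcon
  have hends : ∀ e ∈ L, g e ⊆ V ∧ #(g e) = 2 := fun e he => by
    refine ⟨?_, hg.card_eq (hF (hL.1 he))⟩
    rw [← coe_subset, ← hV]
    exact hg.coe_subset_vertexSet (hF (hL.1 he))
  obtain ⟨y, hyV, hyx, hy⟩ : ∃ y ∈ V, y ≠ x ∧ ¬ Even (deg g L y) := by
    by_contra! hall
    have h1 := sum_deg hends
    rw [← add_sum_erase V _ hxV] at h1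
    have h2 : Even (∑ v ∈ V.erase x, deg g L v) := even_sum _ fun v hv =>
      hall v (mem_of_mem_erase hv) (ne_of_mem_erase hv)
    have h3 : Even (deg g L x + ∑ v ∈ V.erase x, deg g L v) := h1 ▸ even_two_mul _
    exact hx ((Nat.even_add.1 h3).2 h2)
  obtain ⟨p⟩ := hc.2 x (by rw [vertexSet_restrict, hV]; exact hxV) y
    (by rw [vertexSet_restrict, hV]; exact hyV)
  obtain ⟨q, hq, -⟩ := p.exists_path
  have htr := q.isTrail_of_nodup_support hq
  have : (G.restrict (F₂ : Set β)).Loopless := Loopless.anti restrict_le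
  have hdeg := q.deg_edges_add (hg.mono restrict_le) htr
  have hqF : q.edges.toFinset ⊆ F₂ := fun e he => by
    have := q.mem_edgeSet_of_mem_edges e (List.mem_toFinset.1 he)
    rw [edgeSet_restrict] at this
    exact this.2
  have hL' : symmDiff L q.edges.toFinset ⊆ F₁ ∪ F₂ ∧ F₁ ⊆ symmDiff L q.edges.toFinset := by
    constructor
    · intro e he
      rw [mem_symmDiff] at he
      rcases he with he | he
      · exact hL.1 he.1
      · exact mem_union_right _ (hqF he.1)
    · intro e he
      exact mem_symmDiff.2 (Or.inl ⟨hL.2 he, fun h => disjoint_left.1 hd he (hqF h)⟩)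
  refine (hmin _ hL').not_gt (card_lt_card ?_)
  have hpar : ∀ v, Even (deg g (symmDiff L q.edges.toFinset) v) ↔
      (Even (deg g L v) ↔ (x ≠ v ∧ y ≠ v)) := by
    intro v
    have h1 := deg_symmDiff (g := g) (L := L) (P := q.edges.toFinset) v
    have h2 := hdeg v
    have h3 : Even (deg g q.edges.toFinset v) ↔ (x ≠ v ∧ y ≠ v) := by
      by_cases h4 : x = v
      · subst h4
        simp only [if_neg hyx, if_true] at h2
        simp only [ne_eq, not_true, false_and, iff_false, Nat.even_iff]
        omega
      · by_cases h5 : y = v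
        · subst h5
          simp only [if_neg h4, if_true] at h2
          simp only [ne_eq, not_true, and_false, iff_false, Nat.even_iff]
          omega
        · simp only [if_neg h4, if_neg h5] at h2
          simp only [ne_eq, h4, h5, not_false_iff, and_self, iff_true, Nat.even_iff]
          omega
    rw [← h3, ← Nat.even_add, ← h1, Nat.even_add]
    simp
  rw [ssubset_iff_of_subset]
  · refine ⟨x, mem_filter.2 ⟨hxV, hx⟩, fun h => (mem_filter.1 h).2 ?_⟩
    rw [hpar]
    simp [hx]
  · intro v hv
    rw [mem_filter, hpar] at hv
    refine mem_filter.2 ⟨hv.1, fun hev => ?_⟩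
    have h1 : x ≠ v := by
      rintro rfl
      exact hx hev
    have h2 : y ≠ v := by
      rintro rfl
      exact hy hev
    exact hv.2 (by simp [hev, h1, h2])

/-- A connected spanning subgraph with even degrees contains a spanning closed trail. -/
lemma exists_spanning_closed_trail [G.Loopless] (hg : G.IsEnds g) (hV : G.vertexSet = V)
    (hL : (L : Set β) ⊆ G.edgeSet) (hFL : F₁ ⊆ L) (hc : (G.restrict F₁).IsConnected)
    (heven : ∀ v ∈ V, Even (deg g L v)) :
    ∃ (x : α) (p : G.Walk x x), p.IsTrail ∧ p.edges.toFinset ⊆ L ∧ ∀ v ∈ V, v ∈ p.support := by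
  obtain ⟨r, hr⟩ := hc.1
  rw [vertexSet_restrict] at hr
  obtain ⟨n, ⟨x, y, p, htr, hpL, hlen⟩, hmax⟩ : ∃ n,
      (∃ (x y : α) (p : G.Walk x y), p.IsTrail ∧ p.edges.toFinset ⊆ L ∧ p.edges.length = n) ∧
      ∀ (x y : α) (p : G.Walk x y), p.IsTrail → p.edges.toFinset ⊆ L → p.edges.length ≤ n := by
    have hbdd : ∀ (x y : α) (p : G.Walk x y), p.IsTrail → p.edges.toFinset ⊆ L →
        p.edges.length ≤ #L := fun x y p h1 h2 => by
      rw [← List.toFinset_card_of_nodup h1]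
      exact card_le_card h2
    classical
    let P : ℕ → Prop := fun n => ∃ (x y : α) (p : G.Walk x y), p.IsTrail ∧
      p.edges.toFinset ⊆ L ∧ p.edges.length = n
    have hP0 : P 0 := ⟨r, r, Walk.nil r hr, by simp [Walk.IsTrail, Walk.edges],
      by simp [Walk.edges], rfl⟩
    exact ⟨Nat.findGreatest P #L, Nat.findGreatest_spec (Nat.zero_le _) hP0,
      fun x y p h1 h2 => Nat.le_findGreatest (hbdd x y p h1 h2) ⟨x, y, p, h1, h2, rfl⟩⟩
  -- a longest trail cannot be extended
  have hext : ∀ (x y z : α) (p : G.Walk x y) (e : β), p.IsTrail → p.edges.toFinset ⊆ L →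
      p.edges.length = n → e ∈ L → G.IsLink e z x → e ∈ p.edges := by
    intro x y z p e h1 h2 h3 he h
    by_contra hcon
    have := hmax z y (Walk.cons z e h p) (List.nodup_cons.2 ⟨hcon, h1⟩) (by
      simp only [Walk.edges, List.toFinset_cons]
      exact insert_subset he h2)
    simp only [Walk.edges, List.length_cons] at this
    omega
  -- A longest trail uses all edges of `L` at its start; if it were not closed, it would use an odd
  -- number of them.
  have hxy : y = x := by
    by_contra hne
    have h1 := p.deg_edges_add hg htr x
    rw [if_pos rfl, if_neg hne] at h1
    have hxV : x ∈ V := by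
      have := p.mem_vertexSet_of_mem_support x p.start_mem_support
      rwa [hV] at this
    have h2 : L.filter (fun e => x ∈ g e) = p.edges.toFinset.filter (fun e => x ∈ g e) := by
      refine Subset.antisymm (fun e he => ?_) (filter_subset_filter _ hpL)
      rw [mem_filter] at he ⊢
      obtain ⟨w, hw⟩ := (hg.mem_iff_inc (hL he.1)).1 he.2
      exact ⟨List.mem_toFinset.2 (hext x y w p e htr hpL hlen he.1 hw.symm), he.2⟩
    have h3 := heven x hxV
    rw [deg, h2, ← deg, Nat.even_iff] at h3
    omega
  subst hxy
  refine ⟨y, p, htr, hpL, fun v hv => ?_⟩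
  by_contra hcon
  have hyV := p.mem_vertexSet_of_mem_support y p.start_mem_support
  obtain ⟨t⟩ := hc.2 y hyV v (by rw [vertexSet_restrict, hV]; exact hv)
  obtain ⟨e, a, b, he, ha, hb, -, -⟩ := t.exists_link_leaving (A := p.support.toFinset)
    (List.mem_toFinset.2 p.start_mem_support) (fun h => hcon (List.mem_toFinset.1 h))
  rw [restrict_isLink] at he
  -- An edge of `F₁` leaving the visited vertices would extend the closed trail once it is rotated
  -- to start at that edge.
  obtain ⟨q, hq⟩ := p.exists_rotate (List.mem_toFinset.1 ha)
  have heq := hext a a b q e (hq.nodup_iff.2 htr)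
    (by rwa [List.toFinset_eq_of_perm _ _ hq]) (hq.length_eq.trans hlen) (hFL he.1) he.2.symm
  exact hb (List.mem_toFinset.2
    (p.mem_support_of_inc e (hq.mem_iff.1 heq) b he.2.inc_right))

/-- The trivial walk is excluded because it meets its vertex once without using an edge. -/
lemma Walk.two_mul_visits_le [G.Loopless] (hg : G.IsEnds g) (p : G.Walk x x) (hp : p.IsTrail)
    (hB : p.edges.toFinset ⊆ B) (hne : p.edges ≠ []) (v : α) :
    2 * p.visits v ≤ deg g B v := by
  have h1 := p.deg_edges_add hg hp v
  have h2 := deg_mono (g := g) hB v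
  rw [visits_eq]
  cases p with
  | nil => exact absurd rfl hne
  | cons x e h p =>
    have h3 : (cons x e h p).support.count v
        = p.support.count v + (if x = v then 1 else 0) := by
      simp only [support, List.count_cons, beq_iff_eq]
    simp only [cyclicSupport]
    omega

lemma Walk.mem_cyclicSupport (p : G.Walk x x) : ∀ v ∈ p.support, v ∈ p.cyclicSupport := by
  cases p with
  | nil => exact fun v hv => hv
  | cons x e h p =>
    intro v hv
    rcases List.mem_cons.1 hv with rfl | hv
    · exact p.end_mem_support
    · exact hv

lemma hasSpanningClosedTrail_of_deg_le [G.Loopless] (hg : G.IsEnds g) (hV : G.vertexSet = V)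
    (hBE : (B : Set β) ⊆ G.edgeSet) (hB : Sparse 2 g B) (hBV : Tight 2 g B V) {f : α → ℕ}
    (hf : ∀ v ∈ V, 0 < f v) (hdeg : ∀ v ∈ V, deg g B v ≤ 2 * f v + 1) :
    G.HasSpanningClosedTrail f := by
  obtain ⟨-, F₁, F₂, rfl, hd, hT₁, hT₂⟩ := isTreeConnected_of_tight hg hV hBE hB hBV
  obtain ⟨L, hFL, hLB, heven⟩ := exists_even_between hg hV hBE hd hT₂.1
  obtain ⟨x, p, htr, hpL, hspan⟩ := exists_spanning_closed_trail hg hV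
    (fun e he => hBE (hLB he)) hFL hT₁.1 heven
  refine ⟨x, p, htr, fun v hv => ?_⟩
  rw [hV] at hv
  have hv : v ∈ V := hv
  constructor
  · rw [Walk.visits_eq, Nat.one_le_iff_ne_zero, ← Nat.pos_iff_ne_zero, List.count_pos_iff]
    exact p.mem_cyclicSupport v (hspan v hv)
  · by_cases hne : p.edges = []
    · cases p with
      | nil x hx =>
        refine le_trans ?_ (hf v hv)
        rw [Walk.visits_eq]
        exact List.count_le_length
      | cons => simp [Walk.edges] at hne
    · have h1 := p.two_mul_visits_le hg htr (hpL.trans hLB) hne v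
      have h2 := hdeg v hv
      omega

end Graph

/-! ### The theorem -/

theorem mainTheorem6 {α β : Type*} (G : Graph α β) (hV : G.vertexSet.Finite)
    (hE : G.edgeSet.Finite) (hloop : G.Loopless) (hG : Graph.IsTreeConnected 2 G)
    (lam : ℝ) (hlam : lam ∈ Set.Icc (0 : ℝ) (1 / 2))
    (f : α → ℕ) (hf : ∀ v ∈ G.vertexSet, 0 < f v)
    (hS : ∀ S : Finset α, (S : Set α) ⊆ G.vertexSet →
      Graph.treeOmega 2 (G.deleteVerts (S : Set α)) <
        (∑ v ∈ S, ((f v : ℝ) + 2 * lam - 3 / 2)) + 5 / 2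
          - lam * ((G.insideEdges (S : Set α) : ℝ) + 2)) :
    G.HasSpanningClosedTrail f := by
  classical
  obtain ⟨V, hV'⟩ := hV.exists_finset_coe
  obtain ⟨E, hE'⟩ := hE.exists_finset_coe
  obtain ⟨g, hg⟩ := G.exists_isEnds
  have hgE : ∀ e ∈ E, g e ⊆ V ∧ #(g e) = 2 := fun e he => by
    have heG : e ∈ G.edgeSet := by rw [← hE']; exact he
    refine ⟨?_, hg.card_eq heG⟩
    rw [← coe_subset, hV']
    exact hg.coe_subset_vertexSet heG
  have hex : ∃ B ⊆ E, EdgeCount.Sparse 2 g B ∧ EdgeCount.Tight 2 g B V := by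
    obtain ⟨F₁, F₂, h1, h2, hd, hs₁, ht₁, hs₂, ht₂⟩ := hG.exists_forests hg hV'.symm hE
    rw [← hE', coe_subset] at h1 h2
    exact ⟨F₁ ∪ F₂, union_subset h1 h2, hs₁.union hs₂, ht₁.union hd ht₂⟩
  -- The bound may be odd: twice the number of visits is at most the degree in `B`, so the extra one
  -- costs nothing.
  rcases EdgeCount.exists_bounded_or_obstruction hgE hex (fun v => 2 * f v + 1) with
    ⟨B, hBE, hB, hBV, hdeg⟩ | ⟨B, hBE, hB, hBV, S, hSV, hle, ⟨z, hzS, hz⟩, hcl⟩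
  · refine Graph.hasSpanningClosedTrail_of_deg_le hg hV'.symm ?_ hB hBV (fun v hv => hf v ?_) hdeg
    · rw [← hE', coe_subset]
      exact hBE
    · rw [← hV']
      exact hv
  exfalso
  have hB2 : ∀ e ∈ B, #(g e) = 2 := fun e he => (hgE e (hBE he)).2
  have hlt := hS S (by rw [← hV', coe_subset]; exact hSV)
  have hloop' : (G.deleteVerts (S : Set α)).Loopless := Graph.Loopless.anti Graph.deleteVerts_le
  have homega := Graph.two_mul_treeOmega (G := G.deleteVerts (S : Set α)) (V := V \ S)
    (E := E.filter fun e => Disjoint (g e) S) (B := B.filter fun e => Disjoint (g e) S)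
    (hg.mono Graph.deleteVerts_le) (by rw [Graph.vertexSet_deleteVerts, ← hV', coe_sdiff])
    (by
      ext e
      rw [Graph.edgeSet_deleteVerts, coe_filter, Set.mem_ofPred_eq, Set.mem_ofPred_eq,
        ← mem_coe, hE']
      constructor
      · rintro ⟨x, y, h, hx, hy⟩
        refine ⟨h.edge_mem, ?_⟩
        rw [hg e x y h, disjoint_insert_left, disjoint_singleton_left]
        exact ⟨hx, hy⟩
      · rintro ⟨he, hd⟩
        obtain ⟨x, y, h⟩ := Graph.exists_isLink_of_mem_edgeSet he
        rw [hg e x y h, disjoint_insert_left, disjoint_singleton_left] at hd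
        exact ⟨x, y, h, hd⟩)
    (filter_subset_filter _ hBE) (hB.mono (filter_subset _ _)) (fun e he => by
      rw [mem_filter] at he
      refine (hcl e he.1 he.2).imp (fun h => mem_filter.2 ⟨h, he.2⟩) ?_
      rintro ⟨X, hXV, hX, heX, hXS⟩
      refine ⟨X, fun v hv => mem_sdiff.2 ⟨hXV hv, disjoint_left.1 hXS hv⟩, ⟨hX.1, ?_⟩, heX⟩
      have : EdgeCount.inside g (B.filter fun e => Disjoint (g e) S) X
          = EdgeCount.inside g B X := by
        ext c
        simp only [EdgeCount.mem_inside, mem_filter]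
        exact ⟨fun h => ⟨h.1.1, h.2⟩, fun h => ⟨⟨h.1, hXS.mono_left h.2⟩, h.2⟩⟩
      rw [this]
      exact hX.2)
  have hcount := EdgeCount.card_avoiding_add_sum_deg hB2 S
  have hcardB := hBV.2
  rw [EdgeCount.inside_eq_self fun e he => (hgE e (hBE he)).1] at hcardB
  -- The extra one comes from the vertex `z` of too large degree; without it the final inequality
  -- falls short by 1/2.
  have hsum : ∑ v ∈ S, (2 * f v + 1) + 1 ≤ ∑ v ∈ S, EdgeCount.deg g B v :=
    sum_lt_sum hle ⟨z, hzS, hz⟩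
  rw [sum_add_distrib, ← mul_sum, ← card_eq_sum_ones] at hsum
  have hin2 := hB S ⟨z, hzS⟩
  have hin1 : #(EdgeCount.inside g B S) ≤ G.insideEdges (S : Set α) := by
    rw [Graph.insideEdges, ← Set.ncard_coe_finset]
    refine Set.ncard_le_ncard (fun e he => ?_) (hE.subset ?_)
    · rw [mem_coe, EdgeCount.mem_inside] at he
      have heG : e ∈ G.edgeSet := by rw [← hE']; exact hBE he.1
      obtain ⟨x, y, h⟩ := Graph.exists_isLink_of_mem_edgeSet heG
      rw [hg e x y h, insert_subset_iff, singleton_subset_iff] at he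
      exact ⟨x, he.2.1, y, he.2.2, h⟩
    · rintro e ⟨x, -, y, -, h⟩
      exact h.edge_mem
  have hVS := card_sdiff_add_card_eq_card hSV
  rw [sum_sub_distrib, sum_add_distrib, sum_const, sum_const, nsmul_eq_mul, nsmul_eq_mul] at hlt
  have hcount' : (#(B.filter fun e => Disjoint (g e) S) : ℝ) + ∑ v ∈ S, (EdgeCount.deg g B v : ℝ)
      = #B + #(EdgeCount.inside g B S) := by exact_mod_cast hcount
  have hcardB' : (#B : ℝ) + 2 = 2 * #V := by exact_mod_cast hcardB
  have hsum' : 2 * ∑ v ∈ S, (f v : ℝ) + #S + 1 ≤ ∑ v ∈ S, (EdgeCount.deg g B v : ℝ) := by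
    exact_mod_cast hsum
  have hin2' : (#(EdgeCount.inside g B S) : ℝ) + 2 ≤ 2 * #S := by exact_mod_cast hin2
  have hin1' : (#(EdgeCount.inside g B S) : ℝ) ≤ G.insideEdges (S : Set α) := by
    exact_mod_cast hin1
  have hVS' : (#(V \ S) : ℝ) + #S = #V := by exact_mod_cast hVS
  -- The term e_B(S)/2 is split with weights 1/2 - λ and λ, both nonnegative: the first part is
  -- bounded by sparsity on `S`, the second by e_G(S).
  have h1 := mul_le_mul_of_nonneg_left hin2' (sub_nonneg.2 hlam.2)
  have h2 := mul_le_mul_of_nonneg_left hin1' hlam.1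
  linarith
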